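/- **Setting.** Let $N\ge 2$, let $\phi:[0,\infty)\to[0,\infty)$ be of class $C^1$ on $(0,\infty)$ with $\phi(t)>0$ and $(\phi(t)t)'>0$ for all $t>0$, and put $\Phi(t)=\int_0^{|t|}\phi(s)s\,ds$. Assume that there are $l,m\in(1,N)$ with $l\le m<\frac{Nl}{N-l}$ and $$l\le \frac{\phi(t)t^2}{\Phi(t)}\le m\qquad\text{for all }t>0.$$ Let $\Phi_*$ be the Sobolev conjugate of $\Phi$: on $[0,\infty)$ it is the inverse function of $t\mapsto\int_0^t \Phi^{-1}(s)\,s^{-1-1/N}\,ds$, and $\Phi_*(t)=\Phi_*(|t|)$. Let $V:\mathbb R^N\to\mathbb R$ be continuous with $V\ge V_0$ for a constant $V_0>0$. Let $\Omega_i\subset\mathbb R^N$ be a bounded open set, $\Omega_{\epsilon,i}=\Omega_i/\epsilon$ for $\epsilon>0$, and for every $\epsilon>0$ let $\widetilde\Omega_{\epsilon,i}$ be an open set with $\overline{\Omega_{\epsilon,i}}\subset\widetilde\Omega_{\epsilon,i}$. Assume that there is a finite cone $\mathcal K$ such that, for all sufficiently small $\epsilon>0$, each $x\in\Omega_{\epsilon,i}$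 is the vertex of a finite cone congruent to $\mathcal K$ and contained in $\widetilde\Omega_{\epsilon,i}$. (This holds, in particular, if $\Omega_i$ has the cone property, and also if $\widetilde\Omega_{\epsilon,i}=\widetilde\Omega_i/\epsilon$ for a fixed open set $\widetilde\Omega_i\supset\overline{\Omega_i}$.) Let $\widetilde X_{\epsilon,i}$ be the space $W^{1,\Phi}(\widetilde\Omega_{\epsilon,i})$ with $$\|u\|_{\widetilde X_{\epsilon,i}}=\inf\Big\{\lambda>0:\int_{\widetilde\Omega_{\epsilon,i}}\Phi\Big(\frac{|\nabla u|}{\lambda}\Big)dx\le1\Big\}+\inf\Big\{\lambda>0:\int_{\widetilde\Omega_{\epsilon,i}}V(\epsilon x)\,\Phi\Big(\frac{|u|}{\lambda}\Big)dx\le1\Big\}\in[0,\infty].$$ **Proposition.** Let $\varrho>0$, let $\epsilon_n\in(0,\infty)$ with $\epsilon_n\to0$, and let $v_n\in\widetilde X_{\epsilon_n,i}$ be a sequence such that, for some constant $C_0>0$, $$\|v_n\|_{\widetilde X_{\epsilon_n,i}}\le C_0\ \text{ for all } n\qquad\text{and}\qquad \lim_{n\to\infty}\ \sup_{y\in\mathbb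 R^N}\int_{B_\varrho(y)\cap\Omega_{\epsilon_n,i}}\Phi(|v_n|)\,dx=0 .$$ Then $$\lim_{n\to\infty}\int_{\Omega_{\epsilon_n,i}}B(|v_n|)\,dx=0$$ for every N-function $B$ (an even, continuous, convex function $B:\mathbb R\to[0,\infty)$ vanishing only at $0$, with $B(t)/t\to0$ as $t\to0^+$ and $B(t)/t\to\infty$ as $t\to\infty$) that satisfies the $\Delta_2$-condition $B(2t)\le K\,B(t)$ for all $t\ge0$, with some constant $K>0$, and $$\lim_{t\to0}\frac{B(t)}{\Phi(t)}=0,\qquad \lim_{|t|\to\infty}\frac{B(t)}{\Phi_*(t)}=0 .$$ -/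

import Mathlib

open MeasureTheory Filter Topology Set
open scoped ENNReal

/-- `Φ(t) = ∫₀^{|t|} φ(s) s ds`. -/
noncomputable def primitivePhi (φ : ℝ → ℝ) (t : ℝ) : ℝ :=
  ∫ s in (0 : ℝ)..|t|, φ s * s

/-- The inverse of `A`, viewed as a bijection of `[0, ∞)`. -/
noncomputable def halfLineInv (A : ℝ → ℝ) : ℝ → ℝ :=
  Function.invFunOn A (Ici 0)

/-- `G_A(t) = ∫₀ᵗ A⁻¹(s) / s^{1 + 1/N} ds`. -/
noncomputable def sobolevG (N : ℕ) (A : ℝ → ℝ) (t : ℝ) : ℝ :=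
  ∫ s in (0 : ℝ)..t, halfLineInv A s / s ^ (1 + 1 / (N : ℝ))

/-- The Sobolev conjugate `A_*`: the inverse function of `G_A` on `[0, ∞)`, extended evenly. -/
noncomputable def sobolevConj (N : ℕ) (A : ℝ → ℝ) (t : ℝ) : ℝ :=
  halfLineInv (sobolevG N A) |t|

/-- N-functions (as even functions on `ℝ`). -/
structure IsNFunction (A : ℝ → ℝ) : Prop where
  even : ∀ t, A (-t) = A t
  continuous : Continuous A
  convex : ConvexOn ℝ univ A
  eq_zero_iff : ∀ t, A t = 0 ↔ t = 0
  div_tendsto_zero : Tendsto (fun t => A t / t) (𝓝[>] 0) (𝓝 0)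
  div_tendsto_atTop : Tendsto (fun t => A t / t) atTop atTop

/-- The `Δ₂`-condition. -/
def SatisfiesDelta2 (A : ℝ → ℝ) : Prop :=
  ∃ K > 0, ∀ t ≥ 0, A (2 * t) ≤ K * A t

/-- The (weighted) Luxemburg norm
`inf {r > 0 : ∫_U w(x) A(|f(x)| / r) dx ≤ 1}`, with value `∞` if there is no such `r`. -/
noncomputable def luxemburgNorm {N : ℕ} {F : Type*} [NormedAddCommGroup F] (A : ℝ → ℝ)
    (w : EuclideanSpace ℝ (Fin N) → ℝ) (U : Set (EuclideanSpace ℝ (Fin N)))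
    (f : EuclideanSpace ℝ (Fin N) → F) : ℝ≥0∞ :=
  sInf {R : ℝ≥0∞ | ∃ r : ℝ, 0 < r ∧ R = ENNReal.ofReal r ∧
    ∫⁻ x in U, ENNReal.ofReal (w x * A (‖f x‖ / r)) ≤ 1}

/-- `f ∈ L^A(U)`. -/
def MemOrlicz {N : ℕ} {F : Type*} [NormedAddCommGroup F] (A : ℝ → ℝ)
    (U : Set (EuclideanSpace ℝ (Fin N))) (f : EuclideanSpace ℝ (Fin N) → F) : Prop :=
  AEStronglyMeasurable f (volume.restrict U) ∧
    ∃ r : ℝ, 0 < r ∧ ∫⁻ x in U, ENNReal.ofReal (A (‖f x‖ / r)) < ⊤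

/-- `g` is a weak gradient of `u` on the open set `U`. -/
structure IsWeakGradient {N : ℕ} (U : Set (EuclideanSpace ℝ (Fin N)))
    (u : EuclideanSpace ℝ (Fin N) → ℝ)
    (g : EuclideanSpace ℝ (Fin N) → EuclideanSpace ℝ (Fin N)) : Prop where
  locallyIntegrable : LocallyIntegrableOn u U volume
  locallyIntegrable_grad : LocallyIntegrableOn g U volume
  integral_eq : ∀ ψ : EuclideanSpace ℝ (Fin N) → ℝ,
    ContDiff ℝ (⊤ : ℕ∞) ψ → HasCompactSupport ψ → tsupport ψ ⊆ U →
      ∀ e : EuclideanSpace ℝ (Fin N),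
        ∫ x in U, u x * fderiv ℝ ψ x e = - ∫ x in U, inner ℝ (g x) e * ψ x

open Classical in
/-- The weak gradient of `u` on `U` (unique up to null sets; `0` if there is none). -/
noncomputable def weakGradient {N : ℕ} (U : Set (EuclideanSpace ℝ (Fin N)))
    (u : EuclideanSpace ℝ (Fin N) → ℝ) : EuclideanSpace ℝ (Fin N) → EuclideanSpace ℝ (Fin N) :=
  if h : ∃ g, IsWeakGradient U u g then h.choose else 0

/-- `u ∈ W^{1,A}(U)`. -/
def MemOrliczSobolev {N : ℕ} (A : ℝ → ℝ) (U : Set (EuclideanSpace ℝ (Fin N)))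
    (u : EuclideanSpace ℝ (Fin N) → ℝ) : Prop :=
  MemOrlicz A U u ∧ ∃ g, IsWeakGradient U u g ∧ MemOrlicz A U g

/-- The norm `‖∇u‖_{A,U} + ‖u‖_{A,V_ε,U}` on `W^{1,A}(U)`, where `V_ε(x) = V(ε x)`. -/
noncomputable def normX {N : ℕ} (A : ℝ → ℝ) (V : EuclideanSpace ℝ (Fin N) → ℝ) (ε : ℝ)
    (U : Set (EuclideanSpace ℝ (Fin N))) (u : EuclideanSpace ℝ (Fin N) → ℝ) : ℝ≥0∞ :=
  luxemburgNorm A (fun _ => 1) U (weakGradient U u) +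
    luxemburgNorm A (fun x => V (ε • x)) U u

/-- The dilated set `Ω / ε = {x : ε x ∈ Ω}`. -/
def dilate {N : ℕ} (Ω : Set (EuclideanSpace ℝ (Fin N))) (ε : ℝ) :
    Set (EuclideanSpace ℝ (Fin N)) :=
  {x | ε • x ∈ Ω}

/-- The finite cone with vertex `x`, axis direction `ξ` (a unit vector), height `h` and
half-opening angle `arccos c`. -/
def finiteCone {N : ℕ} (x ξ : EuclideanSpace ℝ (Fin N)) (h c : ℝ) :
    Set (EuclideanSpace ℝ (Fin N)) :=
  {y | ‖y - x‖ ≤ h ∧ c * ‖y - x‖ ≤ inner ℝ (y - x) ξ}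

/-- For all small `ε > 0`, every point of `Ω/ε` is the vertex of a finite cone contained in
`Ωt ε`, all these cones being congruent to one fixed cone. -/
def UniformConeIn {N : ℕ} (Ω : Set (EuclideanSpace ℝ (Fin N)))
    (Ωt : ℝ → Set (EuclideanSpace ℝ (Fin N))) : Prop :=
  ∃ h c ε₀ : ℝ, 0 < h ∧ 0 < c ∧ c < 1 ∧ 0 < ε₀ ∧
    ∀ ε, 0 < ε → ε < ε₀ → ∀ x ∈ dilate Ω ε, ∃ ξ, ‖ξ‖ = 1 ∧ finiteCone x ξ h c ⊆ Ωt ε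

/-!
The proof rests on a pointwise potential estimate and the Hardy–Littlewood maximal function.

Let `Φ = primitivePhi φ`. If a point `x` is the vertex of a cone of fixed size inside `U`, average
`u` against a bump supported in that cone and shrunk towards `x` by a factor `t`. The derivative of
this average in `t` is a divergence, so it only involves the weak gradient, and summing over dyadic
`t` gives, for almost every such `x` and every `j`,
`|u(x)| ≤ C (⨍ |u| + ∑_{k ≥ j} 2^{-k} ⨍ |∇u|)`, with averages over the balls of radius `h 2^{-k}`
about `x` intersected with `U` (the first one with `k = j`); see `exists_potential_estimate`. The
constant depends only on the cone, hence neither on `ε` nor on the domain.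

Write `f = (|∇u| + |u|) / R` on `U`, and let `M` be the dyadic maximal function. As the lower growth
exponent `l` exceeds `1`, `∫ Φ(M f) ≤ C ∫ Φ(f)` (`HasGrowthBetween.exists_maximal_modular`). Two
consequences carry the result.

* Sobolev embedding. The average of `f` over a ball of radius `2^{-k}` is bounded by `M f` and, by
  the modular bound, by a multiple of `Φ⁻¹(κ 2^{kN})`. Using the second bound up to the scale where
  the two cross and the first one beyond it yields `∑ 2^{-k} ⨍ f ≤ C G_Φ(Φ(M f))`, that is
  `Φ_*(|u| / C) ≤ Φ(M f)`, so `∫ Φ_*(|u| / C)` is bounded uniformly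
  (`HasGrowthBetween.exists_sobolevConj_le`).
* Superlevel sets. If `|u(x)| ≥ a`, then either `M f(x)` is of order at least `2^j`, which happens
  on a set of small measure for large `j`, or the average of `f` over a ball of radius `h 2^{-j} < ρ`
  is bounded below. By Tonelli's theorem the measure of the latter set is at most a constant times
  the largest measure it has inside such a ball, and this tends to `0` by the vanishing hypothesis
  (`HasGrowthBetween.exists_volume_superlevel_le`).

Finally `B(t) ≤ δ Φ(t) + δ Φ_*(t) + C_δ 1_{t ≥ a}`, and the `Δ₂`-condition on `B` absorbs the
dilation of `u`.
-/

/-! ### Functions of power-like growth -/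

/-- `A` vanishes at `0`, is positive and continuous on the half-line, and `A(t) / t^l` is
nondecreasing while `A(t) / t^m` is nonincreasing. For the primitive `Φ` of `φ(t) t` this is the
integrated form of `l ≤ φ(t) t² / Φ(t) ≤ m`. -/
structure HasGrowthBetween (A : ℝ → ℝ) (l m : ℝ) : Prop where
  zero : A 0 = 0
  pos : ∀ t, 0 < t → 0 < A t
  continuousOn : ContinuousOn A (Ici 0)
  le_rpow_mul : ∀ s t, 0 < s → s ≤ t → A s ≤ (s / t) ^ l * A t
  rpow_mul_le : ∀ s t, 0 < s → s ≤ t → (s / t) ^ m * A t ≤ A s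

lemma monotoneOn_mul_self {φ : ℝ → ℝ} (hφ : ContDiffOn ℝ 1 φ (Ioi 0))
    (hφ1 : ∀ t : ℝ, 0 < t → 0 < φ t ∧ 0 < deriv (fun s => φ s * s) t) :
    MonotoneOn (fun s => φ s * s) (Ici 0) := by
  have hc : ContinuousOn (fun s => φ s * s) (Ioi 0) := hφ.continuousOn.mul continuousOn_id
  have hs : StrictMonoOn (fun s => φ s * s) (Ioi 0) :=
    strictMonoOn_of_deriv_pos (convex_Ioi 0) hc fun x hx => (hφ1 x (by simpa using hx)).2
  intro s hs0 t ht0 hst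
  rcases eq_or_lt_of_le (show (0 : ℝ) ≤ s from hs0) with rfl | hs0'
  · rcases eq_or_lt_of_le (show (0 : ℝ) ≤ t from ht0) with rfl | ht0'
    · exact le_rfl
    · simpa using (mul_pos (hφ1 t ht0').1 ht0').le
  · exact hs.monotoneOn hs0' (hs0'.trans_le hst) hst

lemma hasGrowthBetween_primitivePhi {φ : ℝ → ℝ} {l m : ℝ} (hφ : ContDiffOn ℝ 1 φ (Ioi 0))
    (hφ1 : ∀ t : ℝ, 0 < t → 0 < φ t ∧ 0 < deriv (fun s => φ s * s) t)
    (hφ2 : ∀ t : ℝ, 0 < t →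
      l ≤ φ t * t ^ 2 / primitivePhi φ t ∧ φ t * t ^ 2 / primitivePhi φ t ≤ m) :
    HasGrowthBetween (primitivePhi φ) l m := by
  have hmono := monotoneOn_mul_self hφ hφ1
  have hint : ∀ t, 0 ≤ t → IntervalIntegrable (fun s => φ s * s) volume 0 t := fun t ht =>
    (hmono.mono (by rw [uIcc_of_le ht]; exact Icc_subset_Ici_self)).intervalIntegrable
  have hpos : ∀ t, 0 < t → 0 < primitivePhi φ t := by
    intro t ht
    rw [primitivePhi, abs_of_pos ht]
    exact intervalIntegral.intervalIntegral_pos_of_pos_on (hint t ht.le)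
      (fun s hs => mul_pos (hφ1 s hs.1).1 hs.1) ht
  have hderiv : ∀ t, 0 < t → HasDerivAt (primitivePhi φ) (φ t * t) t := by
    intro t ht
    have hc : ContinuousOn (fun s => φ s * s) (Ioi 0) := hφ.continuousOn.mul continuousOn_id
    have h := intervalIntegral.integral_hasDerivAt_right (hint t ht.le)
      (hc.stronglyMeasurableAtFilter isOpen_Ioi t ht) (hc.continuousAt (Ioi_mem_nhds ht))
    refine h.congr_of_eventuallyEq ?_
    filter_upwards [Ioi_mem_nhds ht] with s hs
    rw [primitivePhi, abs_of_pos hs]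
  have hcont : ContinuousOn (primitivePhi φ) (Ici 0) := by
    intro t ht
    have ht' : (0 : ℝ) ≤ t := ht
    have h : IntegrableOn (fun s => φ s * s) (uIcc 0 (t + 1)) := by
      rw [uIcc_of_le (by linarith), integrableOn_Icc_iff_integrableOn_Ioc]
      exact (intervalIntegrable_iff_integrableOn_Ioc_of_le (by linarith)).1
        (hint (t + 1) (by linarith))
    have h1 := intervalIntegral.continuousOn_primitive_interval h
    rw [uIcc_of_le (by linarith)] at h1
    have h2 : ContinuousWithinAt (fun x => ∫ s in (0 : ℝ)..x, φ s * s) (Ici 0) t := by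
      refine (h1 t ⟨ht', by linarith⟩).mono_of_mem_nhdsWithin ?_
      rw [← Ici_inter_Iic]
      exact inter_mem_nhdsWithin _ (Iic_mem_nhds (by linarith))
    refine h2.congr (fun s hs => ?_) ?_
    · rw [primitivePhi, abs_of_nonneg hs]
    · rw [primitivePhi, abs_of_nonneg ht']
  have hlog : ∀ p t, 0 < t → HasDerivAt (fun t => Real.log (primitivePhi φ t) - p * Real.log t)
      (φ t * t / primitivePhi φ t - p * t⁻¹) t := fun p t ht =>
    ((hderiv t ht).log (hpos t ht).ne').sub ((Real.hasDerivAt_log ht.ne').const_mul p)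
  have hq : ∀ t, 0 < t → φ t * t / primitivePhi φ t = φ t * t ^ 2 / primitivePhi φ t * t⁻¹ := by
    intro t ht
    field_simp
  refine ⟨by simp [primitivePhi], hpos, hcont, fun s t hs hst => ?_, fun s t hs hst => ?_⟩
  · have ht := hs.trans_le hst
    have hm : MonotoneOn (fun t => Real.log (primitivePhi φ t) - l * Real.log t) (Ioi 0) := by
      refine monotoneOn_of_deriv_nonneg (convex_Ioi 0)
        (fun x hx => (hlog l x hx).continuousAt.continuousWithinAt)
        (fun x hx => ?_) (fun x hx => ?_)
      · exact (hlog l x (by simpa using hx)).differentiableAt.differentiableWithinAt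
      · have hx' : 0 < x := by simpa using hx
        rw [(hlog l x hx').deriv, hq x hx', ← sub_mul]
        exact mul_nonneg (sub_nonneg.2 (hφ2 x hx').1) (inv_pos.2 hx').le
    have h := hm hs ht hst
    rw [← Real.log_le_log_iff (hpos s hs)
      (mul_pos (Real.rpow_pos_of_pos (div_pos hs ht) _) (hpos t ht)),
      Real.log_mul (Real.rpow_pos_of_pos (div_pos hs ht) _).ne' (hpos t ht).ne',
      Real.log_rpow (div_pos hs ht), Real.log_div hs.ne' ht.ne']
    simp only at h
    linarith
  · have ht := hs.trans_le hst
    have hm : AntitoneOn (fun t => Real.log (primitivePhi φ t) - m * Real.log t) (Ioi 0) := by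
      refine antitoneOn_of_deriv_nonpos (convex_Ioi 0)
        (fun x hx => (hlog m x hx).continuousAt.continuousWithinAt)
        (fun x hx => ?_) (fun x hx => ?_)
      · exact (hlog m x (by simpa using hx)).differentiableAt.differentiableWithinAt
      · have hx' : 0 < x := by simpa using hx
        rw [(hlog m x hx').deriv, hq x hx', ← sub_mul]
        exact mul_nonpos_of_nonpos_of_nonneg (sub_nonpos.2 (hφ2 x hx').2) (inv_pos.2 hx').le
    have h := hm hs ht hst
    rw [← Real.log_le_log_iff
      (mul_pos (Real.rpow_pos_of_pos (div_pos hs ht) _) (hpos t ht)) (hpos s hs),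
      Real.log_mul (Real.rpow_pos_of_pos (div_pos hs ht) _).ne' (hpos t ht).ne',
      Real.log_rpow (div_pos hs ht), Real.log_div hs.ne' ht.ne']
    simp only at h
    linarith

namespace HasGrowthBetween

variable {A : ℝ → ℝ} {l m : ℝ}

lemma nonneg (hA : HasGrowthBetween A l m) {t : ℝ} (ht : 0 ≤ t) : 0 ≤ A t := by
  rcases eq_or_lt_of_le ht with rfl | h
  · exact hA.zero.ge
  · exact (hA.pos t h).le

/-- `A(t) / t` is nondecreasing. -/
lemma le_div_mul (hA : HasGrowthBetween A l m) (hl : 1 ≤ l) {s t : ℝ} (hs : 0 ≤ s)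
    (hst : s ≤ t) : A s ≤ s / t * A t := by
  rcases eq_or_lt_of_le hs with rfl | hs'
  · simp [hA.zero]
  have ht := hs'.trans_le hst
  refine (hA.le_rpow_mul s t hs' hst).trans
    (mul_le_mul_of_nonneg_right ?_ (hA.pos t ht).le)
  simpa using Real.rpow_le_rpow_of_exponent_ge (div_pos hs' ht) ((div_le_one ht).2 hst) hl

lemma strictMonoOn (hA : HasGrowthBetween A l m) (hl : 1 ≤ l) : StrictMonoOn A (Ici 0) := by
  intro s hs t _ hst
  have ht : 0 < t := (show (0 : ℝ) ≤ s from hs).trans_lt hst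
  refine (hA.le_div_mul hl hs hst.le).trans_lt ?_
  exact mul_lt_of_lt_one_left (hA.pos t ht) ((div_lt_one ht).2 hst)

lemma mul_le (hA : HasGrowthBetween A l m) (hl : 1 ≤ l) {t : ℝ} (ht : 1 ≤ t) :
    t * A 1 ≤ A t := by
  have h := hA.le_div_mul hl zero_le_one ht
  have ht0 : 0 < t := by linarith
  rw [div_mul_eq_mul_div, le_div_iff₀ ht0] at h
  linarith

lemma tendsto_atTop (hA : HasGrowthBetween A l m) (hl : 1 ≤ l) : Tendsto A atTop atTop := by
  refine tendsto_atTop_mono' _ ?_ (tendsto_id.atTop_mul_const (hA.pos 1 one_pos))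
  filter_upwards [eventually_ge_atTop 1] with t ht using hA.mul_le hl ht

/-- The `Δ₂`-type bound, from the upper growth exponent. -/
lemma mul_le_rpow (hA : HasGrowthBetween A l m) {k t : ℝ} (hk : 1 ≤ k) (ht : 0 ≤ t) :
    A (k * t) ≤ k ^ m * A t := by
  rcases eq_or_lt_of_le ht with rfl | ht'
  · simp [hA.zero]
  have hk0 : 0 < k := by linarith
  have h := hA.rpow_mul_le t (k * t) ht' (le_mul_of_one_le_left ht hk)
  rw [show t / (k * t) = k⁻¹ by field_simp, Real.inv_rpow hk0.le, inv_mul_le_iff₀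
    (Real.rpow_pos_of_pos hk0 _)] at h
  exact h

/-- A convexity-free substitute for the tangent line inequality. -/
lemma le_add_mul (hA : HasGrowthBetween A l m) (hl : 1 ≤ l) {b t : ℝ} (hb : 0 < b)
    (ht : 0 ≤ t) : t ≤ b + b / A b * A t := by
  have hAb := hA.pos b hb
  rcases le_total t b with h | h
  · have := mul_nonneg (div_pos hb hAb).le (hA.nonneg ht)
    linarith
  · have ht' := hb.trans_le h
    have h1 := hA.le_div_mul hl hb.le h
    rw [div_mul_eq_mul_div, le_div_iff₀ ht'] at h1
    have : t ≤ b / A b * A t := by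
      rw [div_mul_eq_mul_div, le_div_iff₀ hAb]
      linarith
    linarith

lemma add_le (hA : HasGrowthBetween A l m) (hl : 1 ≤ l) {s t : ℝ} (hs : 0 ≤ s) (ht : 0 ≤ t) :
    A (s + t) ≤ 2 ^ m * (A s + A t) := by
  have h2 : (0 : ℝ) ≤ 2 ^ m := by positivity
  rcases le_total s t with h | h
  · have h1 := hA.mul_le_rpow one_le_two ht
    have h3 := (hA.strictMonoOn hl).monotoneOn (add_nonneg hs ht) (by positivity : 0 ≤ 2 * t)
      (by linarith : s + t ≤ 2 * t)
    nlinarith [hA.nonneg hs]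
  · have h1 := hA.mul_le_rpow one_le_two hs
    have h3 := (hA.strictMonoOn hl).monotoneOn (add_nonneg hs ht) (by positivity : 0 ≤ 2 * s)
      (by linarith : s + t ≤ 2 * s)
    nlinarith [hA.nonneg ht]

/-! ### The inverse function and the Sobolev conjugate -/

lemma surjOn (hA : HasGrowthBetween A l m) (hl : 1 ≤ l) : SurjOn A (Ici 0) (Ici 0) := by
  intro s hs
  obtain ⟨T, hT, hT0⟩ := (((hA.tendsto_atTop hl).eventually_ge_atTop s).and
    (eventually_ge_atTop 0)).exists
  obtain ⟨t, ht, rfl⟩ := intermediate_value_Icc hT0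
    (hA.continuousOn.mono Icc_subset_Ici_self) (show s ∈ Icc (A 0) (A T) from
      ⟨by rw [hA.zero]; exact hs, hT⟩)
  exact ⟨t, ht.1, rfl⟩

lemma inv_nonneg (hA : HasGrowthBetween A l m) (hl : 1 ≤ l) {s : ℝ} (hs : 0 ≤ s) :
    0 ≤ halfLineInv A s :=
  Function.invFunOn_mem (hA.surjOn hl hs)

lemma apply_inv (hA : HasGrowthBetween A l m) (hl : 1 ≤ l) {s : ℝ} (hs : 0 ≤ s) :
    A (halfLineInv A s) = s :=
  Function.invFunOn_eq (hA.surjOn hl hs)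

lemma inv_apply (hA : HasGrowthBetween A l m) (hl : 1 ≤ l) {t : ℝ} (ht : 0 ≤ t) :
    halfLineInv A (A t) = t :=
  (hA.strictMonoOn hl).injOn (hA.inv_nonneg hl (hA.nonneg ht)) ht
    (hA.apply_inv hl (hA.nonneg ht))

lemma inv_strictMonoOn (hA : HasGrowthBetween A l m) (hl : 1 ≤ l) :
    StrictMonoOn (halfLineInv A) (Ici 0) := by
  intro s hs t ht hst
  rw [← (hA.strictMonoOn hl).lt_iff_lt (hA.inv_nonneg hl hs) (hA.inv_nonneg hl ht),
    hA.apply_inv hl hs, hA.apply_inv hl ht]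
  exact hst

lemma inv_zero (hA : HasGrowthBetween A l m) (hl : 1 ≤ l) : halfLineInv A 0 = 0 := by
  simpa [hA.zero] using hA.inv_apply hl le_rfl

lemma inv_pos (hA : HasGrowthBetween A l m) (hl : 1 ≤ l) {s : ℝ} (hs : 0 < s) :
    0 < halfLineInv A s := by
  simpa [hA.inv_zero hl] using hA.inv_strictMonoOn hl self_mem_Ici hs.le hs

lemma half_inv_le (hA : HasGrowthBetween A l m) (hl : 1 ≤ l) {s : ℝ} (hs : 0 < s) :
    halfLineInv A s / 2 ≤ halfLineInv A (s / 2) := by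
  have hp := hA.inv_pos hl hs
  rw [← (hA.strictMonoOn hl).le_iff_le (half_pos hp).le (hA.inv_nonneg hl (half_pos hs).le),
    hA.apply_inv hl (half_pos hs).le]
  have h := hA.le_div_mul hl (half_pos hp).le (half_le_self hp.le)
  rw [hA.apply_inv hl hs.le] at h
  refine h.trans (le_of_eq ?_)
  field_simp

lemma inv_le_rpow (hA : HasGrowthBetween A l m) (hl : 1 ≤ l) (hm : 0 < m) {s S : ℝ}
    (hs : 0 < s) (hsS : s ≤ S) :
    halfLineInv A s ≤ halfLineInv A S * (s / S) ^ (1 / m) := by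
  have hS := hs.trans_le hsS
  have h := hA.rpow_mul_le _ _ (hA.inv_pos hl hs)
    ((hA.inv_strictMonoOn hl).monotoneOn hs.le hS.le hsS)
  rw [hA.apply_inv hl hs.le, hA.apply_inv hl hS.le, ← le_div_iff₀ hS] at h
  have hq : 0 ≤ halfLineInv A s / halfLineInv A S :=
    (div_pos (hA.inv_pos hl hs) (hA.inv_pos hl hS)).le
  have h' := Real.rpow_le_rpow (by positivity) h (by positivity : 0 ≤ 1 / m)
  rw [← Real.rpow_mul hq, mul_one_div_cancel hm.ne', Real.rpow_one,
    div_le_iff₀ (hA.inv_pos hl hS)] at h'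
  linarith

/-- The integrand of `sobolevG` is integrable at `0` because `m < N`. -/
lemma intervalIntegrable_sobolevG (hA : HasGrowthBetween A l m) (hl : 1 ≤ l) (hm : 0 < m)
    {N : ℕ} (hN : 0 < N) (hmN : m < N) {S : ℝ} (hS : 0 ≤ S) :
    IntervalIntegrable (fun s => halfLineInv A s / s ^ (1 + 1 / (N : ℝ))) volume 0 S := by
  rcases eq_or_lt_of_le hS with rfl | hS'
  · simp
  have hN' : (0 : ℝ) < N := by exact_mod_cast hN
  set c := halfLineInv A S / S ^ (1 / m)
  have hr : -1 < 1 / m - (1 + 1 / (N : ℝ)) := by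
    have := one_div_lt_one_div_of_lt hm hmN
    linarith
  have hb : IntervalIntegrable (fun s : ℝ => c * s ^ (1 / m - (1 + 1 / (N : ℝ)))) volume 0 S :=
    (intervalIntegral.intervalIntegrable_rpow' hr).const_mul c
  refine hb.mono_fun ?_ ?_
  · rw [uIoc_of_le hS]
    have h1 : AEMeasurable (halfLineInv A) (volume.restrict (Ioc 0 S)) :=
      aemeasurable_restrict_of_monotoneOn measurableSet_Ioc
        ((hA.inv_strictMonoOn hl).monotoneOn.mono fun x hx => hx.1.le)
    exact (h1.div (by fun_prop)).aestronglyMeasurable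
  · rw [uIoc_of_le hS, EventuallyLE, ae_restrict_iff' measurableSet_Ioc]
    refine ae_of_all _ fun s hs => ?_
    have hs0 : 0 < s := hs.1
    have hp : 0 < s ^ (1 + 1 / (N : ℝ)) := Real.rpow_pos_of_pos hs0 _
    rw [Real.norm_of_nonneg (div_nonneg (hA.inv_nonneg hl hs0.le) hp.le)]
    refine le_trans ?_ (le_abs_self _)
    rw [Real.rpow_sub hs0, ← mul_div_assoc]
    gcongr
    refine (hA.inv_le_rpow hl hm hs0 hs.2).trans (le_of_eq ?_)
    rw [Real.div_rpow hs0.le hS]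
    simp only [c]
    ring

/-- A lower bound for the increments of `sobolevG`. -/
lemma le_sobolevG_sub (hA : HasGrowthBetween A l m) (hl : 1 ≤ l) (hm : 0 < m)
    {N : ℕ} (hN : 0 < N) (hmN : m < N) {a b : ℝ} (ha : 0 ≤ a) (hab : a ≤ b) (hb : 0 < b) :
    (b - a) * (halfLineInv A a / b ^ (1 + 1 / (N : ℝ))) ≤ sobolevG N A b - sobolevG N A a := by
  have hIa := hA.intervalIntegrable_sobolevG hl hm hN hmN ha
  have hIb := hA.intervalIntegrable_sobolevG hl hm hN hmN hb.le
  have hIab := hIa.symm.trans hIb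
  rw [sobolevG, sobolevG, intervalIntegral.integral_interval_sub_left hIb hIa]
  have hc : ∫ _ in a..b, (halfLineInv A a / b ^ (1 + 1 / (N : ℝ)))
      = (b - a) * (halfLineInv A a / b ^ (1 + 1 / (N : ℝ))) := by
    rw [intervalIntegral.integral_const, smul_eq_mul]
  rw [← hc]
  refine intervalIntegral.integral_mono_on_of_le_Ioo hab (by simp) hIab fun s hs => ?_
  have hs0 : 0 < s := ha.trans_lt hs.1
  have h1 := (hA.inv_strictMonoOn hl).monotoneOn ha hs0.le hs.1.le
  have h2 := hA.inv_nonneg hl ha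
  have h3 : s ^ (1 + 1 / (N : ℝ)) ≤ b ^ (1 + 1 / (N : ℝ)) :=
    Real.rpow_le_rpow hs0.le hs.2.le (by positivity)
  have h4 : 0 < s ^ (1 + 1 / (N : ℝ)) := Real.rpow_pos_of_pos hs0 _
  have h5 := h2.trans h1
  gcongr

lemma sobolevG_strictMonoOn (hA : HasGrowthBetween A l m) (hl : 1 ≤ l) (hm : 0 < m)
    {N : ℕ} (hN : 0 < N) (hmN : m < N) : StrictMonoOn (sobolevG N A) (Ici 0) := by
  have key : ∀ a b, 0 < a → a < b → sobolevG N A a < sobolevG N A b := by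
    intro a b ha hab
    have hb := ha.trans hab
    have h := hA.le_sobolevG_sub hl hm hN hmN ha.le hab.le hb
    have : 0 < (b - a) * (halfLineInv A a / b ^ (1 + 1 / (N : ℝ))) :=
      mul_pos (sub_pos.2 hab) (div_pos (hA.inv_pos hl ha) (Real.rpow_pos_of_pos hb _))
    linarith
  intro a ha b hb hab
  have ha' : (0 : ℝ) ≤ a := ha
  have hb' : 0 < b := ha'.trans_lt hab
  have h := hA.le_sobolevG_sub hl hm hN hmN ha' (by linarith : a ≤ (a + b) / 2) (by linarith)
  have h2 := key ((a + b) / 2) b (by linarith) (by linarith)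
  have : 0 ≤ ((a + b) / 2 - a) * (halfLineInv A a / ((a + b) / 2) ^ (1 + 1 / (N : ℝ))) :=
    mul_nonneg (by linarith) (div_nonneg (hA.inv_nonneg hl ha')
      (Real.rpow_nonneg (by linarith) _))
  linarith

lemma sobolevG_continuousOn (hA : HasGrowthBetween A l m) (hl : 1 ≤ l) (hm : 0 < m)
    {N : ℕ} (hN : 0 < N) (hmN : m < N) {S : ℝ} (hS : 0 ≤ S) :
    ContinuousOn (sobolevG N A) (Icc 0 S) := by
  have h := hA.intervalIntegrable_sobolevG hl hm hN hmN hS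
  rw [intervalIntegrable_iff_integrableOn_Icc_of_le hS] at h
  have h1 := intervalIntegral.continuousOn_primitive_interval
    (by rwa [uIcc_of_le hS] :
      IntegrableOn (fun s => halfLineInv A s / s ^ (1 + 1 / (N : ℝ))) (uIcc 0 S))
  rwa [uIcc_of_le hS] at h1

lemma sobolevG_zero (N : ℕ) (A : ℝ → ℝ) : sobolevG N A 0 = 0 := by simp [sobolevG]

/-- On the range of `sobolevG` the Sobolev conjugate is a genuine inverse, so `w ≤ G_A(s)` gives
`A_*(w) ≤ s`. -/
lemma sobolevConj_le (hA : HasGrowthBetween A l m) (hl : 1 ≤ l) (hm : 0 < m)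
    {N : ℕ} (hN : 0 < N) (hmN : m < N) {w s : ℝ} (hs : 0 ≤ s) (hw : 0 < w)
    (hws : w ≤ sobolevG N A s) : 0 < sobolevConj N A w ∧ sobolevConj N A w ≤ s := by
  obtain ⟨r, hr, hrw⟩ := intermediate_value_Icc hs
    (hA.sobolevG_continuousOn hl hm hN hmN hs)
    (show w ∈ Icc (sobolevG N A 0) (sobolevG N A s) from ⟨by rw [sobolevG_zero]; exact hw.le, hws⟩)
  have hex : ∃ a ∈ Ici (0 : ℝ), sobolevG N A a = w := ⟨r, hr.1, hrw⟩
  have h1 : 0 ≤ sobolevConj N A w := by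
    rw [sobolevConj, abs_of_pos hw]
    exact Function.invFunOn_mem hex
  have h2 : sobolevG N A (sobolevConj N A w) = w := by
    rw [sobolevConj, abs_of_pos hw]
    exact Function.invFunOn_eq hex
  refine ⟨lt_of_le_of_ne h1 fun h => ?_, ?_⟩
  · rw [← h, sobolevG_zero] at h2
    exact hw.ne h2
  · have h3 := (hA.sobolevG_strictMonoOn hl hm hN hmN).injOn h1 hr.1 (h2.trans hrw.symm)
    rw [h3]
    exact hr.2

lemma inv_le_sobolevG (hA : HasGrowthBetween A l m) (hl : 1 ≤ l) (hm : 0 < m)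
    {N : ℕ} (hN : 0 < N) (hmN : m < N) {s : ℝ} (hs : 0 < s) :
    halfLineInv A s ≤ 4 * s ^ (1 / (N : ℝ)) * sobolevG N A s := by
  have h := hA.le_sobolevG_sub hl hm hN hmN (half_pos hs).le (half_le_self hs.le) hs
  have h0 := (hA.sobolevG_strictMonoOn hl hm hN hmN).monotoneOn self_mem_Ici (half_pos hs).le
    (half_pos hs).le
  rw [sobolevG_zero] at h0
  have h1 := hA.half_inv_le hl hs
  have hp : 0 < s ^ (1 / (N : ℝ)) := Real.rpow_pos_of_pos hs _
  rw [Real.rpow_add hs, Real.rpow_one] at h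
  have h2 : (s - s / 2) * (halfLineInv A (s / 2) / (s * s ^ (1 / (N : ℝ))))
      = halfLineInv A (s / 2) / (2 * s ^ (1 / (N : ℝ))) := by
    field_simp
    ring
  rw [h2, div_le_iff₀ (by positivity)] at h
  nlinarith

/-- The dyadic form of the Sobolev embedding: if the weights `a k` (the averages of a function over
balls of radius `2 ^ (-k)`) are bounded both by `μ` and by the Orlicz bound
`2 A⁻¹(κ 2 ^ (k N))`, then the Riesz-type sum `∑ 2 ^ (-k) a k` is controlled by `G_A(A(μ))`. -/
lemma sum_le_sobolevG (hA : HasGrowthBetween A l m) (hl : 1 ≤ l) (hm : 0 < m)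
    {N : ℕ} (hN : 0 < N) (hmN : m < N) {κ : ℝ} (hκ : 0 < κ) {μ : ℝ} (hμ : 0 ≤ μ) {a : ℕ → ℝ}
    (ha : ∀ k, a k ≤ μ) (ha' : ∀ k, a k ≤ 2 * halfLineInv A (κ * 2 ^ (k * N))) (n : ℕ) :
    ∑ k ∈ Finset.range n, (2⁻¹ : ℝ) ^ k * a k
      ≤ 24 * κ ^ (1 / (N : ℝ)) * sobolevG N A (A μ) := by
  set G := sobolevG N A
  set q := κ ^ (1 / (N : ℝ))
  have hN' : (N : ℝ) ≠ 0 := by exact_mod_cast hN.ne'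
  have hq : 0 < q := Real.rpow_pos_of_pos hκ _
  have hG : MonotoneOn G (Ici 0) := (hA.sobolevG_strictMonoOn hl hm hN hmN).monotoneOn
  have hG0 : G 0 = 0 := sobolevG_zero N A
  have hroot : ∀ k : ℕ, (κ * 2 ^ (k * N)) ^ (1 / (N : ℝ)) = q * 2 ^ k := by
    intro k
    rw [Real.mul_rpow hκ.le (by positivity), pow_mul, ← Real.rpow_natCast _ N,
      ← Real.rpow_mul (by positivity), mul_one_div_cancel hN', Real.rpow_one]
  rcases eq_or_lt_of_le hμ with rfl | hμ'
  · rw [hA.zero, hG0, mul_zero]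
    exact Finset.sum_nonpos fun k _ => mul_nonpos_of_nonneg_of_nonpos (by positivity) (ha k)
  set s := A μ
  have hs : 0 < s := hA.pos μ hμ'
  have hGs : 0 ≤ G s := hG0 ▸ hG self_mem_Ici hs.le hs.le
  have hμs : halfLineInv A s = μ := hA.inv_apply hl hμ
  -- `K` is the scale with `κ 2 ^ (K N) ≈ A μ`, at which the two bounds cross.
  have hex : ∃ K : ℕ, s < κ * 2 ^ ((K + 1) * N) := by
    obtain ⟨K, hK⟩ := pow_unbounded_of_one_lt (s / κ) (one_lt_two : (1 : ℝ) < 2)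
    refine ⟨K, ?_⟩
    rw [div_lt_iff₀' hκ] at hK
    refine hK.trans_le (mul_le_mul_of_nonneg_left (pow_le_pow_right₀ one_le_two ?_) hκ.le)
    nlinarith
  classical
  set K := Nat.find hex
  have hK : s < κ * 2 ^ ((K + 1) * N) := Nat.find_spec hex
  have hlow : ∀ j, j < K → κ * 2 ^ ((j + 1) * N) ≤ s := fun j hj =>
    not_lt.1 (Nat.find_min hex hj)
  -- The head of the sum telescopes against the increments of `G` over dyadic intervals.
  have hstep : ∀ k : ℕ, (2⁻¹ : ℝ) ^ k * (2 * halfLineInv A (κ * 2 ^ (k * N)))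
      ≤ 8 * q * (G (κ * 2 ^ ((k + 1) * N)) - G (κ * 2 ^ (k * N))) := by
    intro k
    have hσ : 0 < κ * 2 ^ (k * N) := by positivity
    have hσ' : 0 < κ * 2 ^ ((k + 1) * N) := by positivity
    have hdbl : 2 * (κ * 2 ^ (k * N)) ≤ κ * 2 ^ ((k + 1) * N) := by
      have : (2 : ℝ) * 2 ^ (k * N) ≤ 2 ^ ((k + 1) * N) := by
        rw [← pow_succ']
        exact pow_le_pow_right₀ one_le_two (by nlinarith)
      nlinarith
    have h := hA.le_sobolevG_sub hl hm hN hmN hσ.le (by linarith) hσ'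
    rw [Real.rpow_add hσ', Real.rpow_one, hroot] at h
    have hP := hA.inv_nonneg hl hσ.le
    set P := halfLineInv A (κ * 2 ^ (k * N))
    set σ' := κ * 2 ^ ((k + 1) * N)
    have h3 : P / (2 * (q * 2 ^ (k + 1))) ≤
        (σ' - κ * 2 ^ (k * N)) * (P / (σ' * (q * 2 ^ (k + 1)))) := by
      rw [show P / (2 * (q * 2 ^ (k + 1))) = σ' / 2 * (P / (σ' * (q * 2 ^ (k + 1)))) by
        field_simp]
      refine mul_le_mul_of_nonneg_right (by linarith) (by positivity)
    have h4 := mul_le_mul_of_nonneg_left (h3.trans h) (by positivity : 0 ≤ 8 * q)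
    refine le_trans (le_of_eq ?_) h4
    rw [inv_pow, pow_succ]
    field_simp
    ring
  have hhead : ∀ n ≤ K, ∑ k ∈ Finset.range n, (2⁻¹ : ℝ) ^ k * a k
      ≤ 8 * q * (G (κ * 2 ^ (n * N)) - G (κ * 2 ^ (0 * N))) := by
    intro n
    induction n with
    | zero => intro _; simp
    | succ n ih =>
      intro hn
      rw [Finset.sum_range_succ]
      have h1 := ih (by omega)
      have h2 := hstep n
      have h3 := mul_le_mul_of_nonneg_left (ha' n) (by positivity : (0 : ℝ) ≤ 2⁻¹ ^ n)
      linarith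
  have hhead' : ∀ n ≤ K, ∑ k ∈ Finset.range n, (2⁻¹ : ℝ) ^ k * a k ≤ 8 * q * G s := by
    intro n hn
    rcases n with _ | n
    · simp only [Finset.range_zero, Finset.sum_empty]
      positivity
    refine (hhead _ hn).trans (mul_le_mul_of_nonneg_left ?_ (by positivity))
    have h0 : 0 ≤ G (κ * 2 ^ (0 * N)) :=
      hG0 ▸ hG self_mem_Ici (show (0 : ℝ) ≤ _ by positivity) (by positivity)
    have h1 := hG (show (0 : ℝ) ≤ κ * 2 ^ ((n + 1) * N) by positivity) hs.le (hlow n (by omega))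
    linarith
  have htail : ∀ j, ∑ k ∈ Finset.range (K + j), (2⁻¹ : ℝ) ^ k * a k
      ≤ 8 * q * G s + 2 * ((2⁻¹ : ℝ) ^ K - 2⁻¹ ^ (K + j)) * μ := by
    intro j
    induction j with
    | zero => simpa using hhead' K le_rfl
    | succ j ih =>
      rw [← add_assoc, Finset.sum_range_succ]
      have h3 := mul_le_mul_of_nonneg_left (ha (K + j)) (by positivity : (0 : ℝ) ≤ 2⁻¹ ^ (K + j))
      rw [pow_succ (2⁻¹ : ℝ) (K + j)]
      linarith
  have hμG : 2 * (2⁻¹ : ℝ) ^ K * μ ≤ 16 * q * G s := by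
    have h1 := hA.inv_le_sobolevG hl hm hN hmN hs
    rw [hμs] at h1
    have h2 : s ^ (1 / (N : ℝ)) ≤ q * 2 ^ (K + 1) := by
      rw [← hroot]
      exact Real.rpow_le_rpow hs.le hK.le (by positivity)
    have h3 : μ ≤ 4 * (q * 2 ^ (K + 1)) * G s := h1.trans (by gcongr)
    calc 2 * (2⁻¹ : ℝ) ^ K * μ ≤ 2 * (2⁻¹ : ℝ) ^ K * (4 * (q * 2 ^ (K + 1)) * G s) := by gcongr
      _ = 16 * q * G s := by
        rw [inv_pow, pow_succ]
        field_simp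
        ring
  rcases le_total n K with h | h
  · refine (hhead' n h).trans ?_
    have : 0 ≤ q * G s := by positivity
    linarith
  · obtain ⟨j, rfl⟩ := Nat.exists_eq_add_of_le h
    refine (htail j).trans ?_
    have : 0 ≤ (2⁻¹ : ℝ) ^ (K + j) * μ := by positivity
    linarith

end HasGrowthBetween

/-! ### The dyadic maximal function -/

section Maximal

set_option linter.unusedSectionVars false

variable {E : Type*} [NormedAddCommGroup E] [NormedSpace ℝ E] [FiniteDimensional ℝ E]
  [MeasureSpace E] [BorelSpace E] [(volume : Measure E).IsAddHaarMeasure]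

/-- The average of `F` over the closed ball of radius `D 2 ^ (-k)` centred at `x`. -/
noncomputable def ballAvg (D : ℝ) (F : E → ℝ≥0∞) (k : ℕ) (x : E) : ℝ≥0∞ :=
  (∫⁻ y in Metric.closedBall x (D * 2⁻¹ ^ k), F y) /
    volume (Metric.closedBall (0 : E) (D * 2⁻¹ ^ k))

/-- The centred Hardy–Littlewood maximal function over the dyadic radii `D 2 ^ (-k)`. A countable
supremum suffices here and makes measurability immediate. -/
noncomputable def dyadicMaximal (D : ℝ) (F : E → ℝ≥0∞) (x : E) : ℝ≥0∞ :=
  ⨆ k, ballAvg D F k x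

lemma dyadic_radius_pos {D : ℝ} (hD : 0 < D) (k : ℕ) : 0 < D * 2⁻¹ ^ k := by positivity

lemma volume_dyadicBall_pos {D : ℝ} (hD : 0 < D) (k : ℕ) :
    0 < volume (Metric.closedBall (0 : E) (D * 2⁻¹ ^ k)) :=
  Metric.measure_closedBall_pos _ _ (dyadic_radius_pos hD k)

lemma volume_dyadicBall_ne_top (D : ℝ) (k : ℕ) :
    volume (Metric.closedBall (0 : E) (D * 2⁻¹ ^ k)) ≠ ∞ :=
  measure_closedBall_lt_top.ne

lemma setLIntegral_eq_ballAvg_mul {D : ℝ} (hD : 0 < D) (F : E → ℝ≥0∞) (k : ℕ) (x : E) :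
    ∫⁻ y in Metric.closedBall x (D * 2⁻¹ ^ k), F y =
      ballAvg D F k x * volume (Metric.closedBall (0 : E) (D * 2⁻¹ ^ k)) :=
  (ENNReal.div_mul_cancel (volume_dyadicBall_pos hD k).ne' (volume_dyadicBall_ne_top D k)).symm

lemma ballAvg_le_dyadicMaximal (D : ℝ) (F : E → ℝ≥0∞) (k : ℕ) (x : E) :
    ballAvg D F k x ≤ dyadicMaximal D F x :=
  le_iSup (fun k => ballAvg D F k x) k

lemma ballAvg_mono {F G : E → ℝ≥0∞} (D : ℝ) (h : ∀ y, F y ≤ G y) (k : ℕ) (x : E) :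
    ballAvg D F k x ≤ ballAvg D G k x :=
  ENNReal.div_le_div_right (lintegral_mono h) _

lemma ballAvg_congr {F G : E → ℝ≥0∞} (D : ℝ) (h : F =ᵐ[volume] G) (k : ℕ) (x : E) :
    ballAvg D F k x = ballAvg D G k x := by
  rw [ballAvg, ballAvg, lintegral_congr_ae (ae_restrict_of_ae h)]

lemma ballAvg_const_mul {F : E → ℝ≥0∞} (hF : Measurable F) (D : ℝ) (c : ℝ≥0∞) (k : ℕ) (x : E) :
    ballAvg D (fun y => c * F y) k x = c * ballAvg D F k x := by
  rw [ballAvg, ballAvg, lintegral_const_mul _ hF, mul_div_assoc]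

lemma ballAvg_const_add {D : ℝ} (hD : 0 < D) (F : E → ℝ≥0∞) (c : ℝ≥0∞) (k : ℕ) (x : E) :
    ballAvg D (fun y => c + F y) k x = c + ballAvg D F k x := by
  rw [ballAvg, ballAvg, lintegral_add_left measurable_const, setLIntegral_const,
    ENNReal.add_div, Measure.addHaar_closedBall_center,
    ENNReal.mul_div_cancel_right (volume_dyadicBall_pos hD k).ne' (volume_dyadicBall_ne_top D k)]

lemma measurable_ballAvg {F : E → ℝ≥0∞} (hF : Measurable F) (D : ℝ) (k : ℕ) :
    Measurable (ballAvg D F k) := by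
  refine Measurable.div_const ?_ _
  have hs : MeasurableSet {p : E × E | dist p.2 p.1 ≤ D * 2⁻¹ ^ k} :=
    measurableSet_le (by fun_prop) measurable_const
  have h : (fun x => ∫⁻ y in Metric.closedBall x (D * 2⁻¹ ^ k), F y) = fun x =>
      ∫⁻ y, {p : E × E | dist p.2 p.1 ≤ D * 2⁻¹ ^ k}.indicator (fun p => F p.2) (x, y) := by
    ext x
    rw [← lintegral_indicator Metric.isClosed_closedBall.measurableSet]
    rfl
  rw [h]
  exact ((hF.comp measurable_snd).indicator hs).lintegral_prod_right'

lemma measurable_dyadicMaximal {F : E → ℝ≥0∞} (hF : Measurable F) (D : ℝ) :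
    Measurable (dyadicMaximal D F) :=
  Measurable.iSup fun k => measurable_ballAvg hF D k

/-- The weak type `(1, 1)` inequality, by the Vitali covering lemma. -/
lemma mul_volume_lt_dyadicMaximal_le {D : ℝ} (hD : 0 < D) (F : E → ℝ≥0∞) (c : ℝ≥0∞) :
    c * volume {x | c < dyadicMaximal D F x} ≤
      ENNReal.ofReal (5 ^ Module.finrank ℝ E) * ∫⁻ x, F x := by
  obtain ⟨u, hut, hdisj, hcov⟩ := Vitali.exists_disjoint_subfamily_covering_enlargement_closedBall
    {p : E × ℕ | c < ballAvg D F p.2 p.1} (fun p => p.1) (fun p => D * 2⁻¹ ^ p.2) D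
    (fun p _ => mul_le_of_le_one_right hD.le (pow_le_one₀ (by norm_num) (by norm_num))) 5
    (by norm_num)
  have hcount : u.Countable := hdisj.countable_of_nonempty_interior fun p _ => by
    rw [interior_closedBall _ (dyadic_radius_pos hD p.2).ne']
    exact ⟨p.1, Metric.mem_ball_self (dyadic_radius_pos hD p.2)⟩
  have hsub : {x | c < dyadicMaximal D F x} ⊆
      ⋃ p ∈ u, Metric.closedBall p.1 (5 * (D * 2⁻¹ ^ p.2)) := by
    intro x hx
    obtain ⟨k, hk⟩ := lt_iSup_iff.1 (show c < ⨆ k, ballAvg D F k x from hx)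
    obtain ⟨p, hp, hxp⟩ := hcov (x, k) hk
    exact mem_biUnion hp (hxp (Metric.mem_closedBall_self (dyadic_radius_pos hD k).le))
  calc c * volume {x | c < dyadicMaximal D F x}
      ≤ c * ∑' p : u, volume (Metric.closedBall p.1.1 (5 * (D * 2⁻¹ ^ p.1.2))) := by
        gcongr
        exact (measure_mono hsub).trans (measure_biUnion_le _ hcount _)
    _ = ENNReal.ofReal (5 ^ Module.finrank ℝ E) *
          ∑' p : u, c * volume (Metric.closedBall (0 : E) (D * 2⁻¹ ^ p.1.2)) := by
        rw [← ENNReal.tsum_mul_left, ← ENNReal.tsum_mul_left]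
        refine tsum_congr fun p => ?_
        rw [Measure.addHaar_closedBall_mul _ _ (by norm_num) (dyadic_radius_pos hD _).le]
        ring
    _ ≤ ENNReal.ofReal (5 ^ Module.finrank ℝ E) *
          ∑' p : u, ∫⁻ y in Metric.closedBall p.1.1 (D * 2⁻¹ ^ p.1.2), F y := by
        gcongr with p
        rw [setLIntegral_eq_ballAvg_mul hD]
        gcongr
        exact (hut p.2).le
    _ = ENNReal.ofReal (5 ^ Module.finrank ℝ E) *
          ∫⁻ y in ⋃ p ∈ u, Metric.closedBall p.1 (D * 2⁻¹ ^ p.2), F y := by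
        rw [lintegral_biUnion hcount (fun p _ => Metric.isClosed_closedBall.measurableSet) hdisj]
    _ ≤ _ := by
        gcongr
        exact Measure.restrict_le_self

/-- The weak type inequality for the part of `F` above the level `c`. -/
lemma mul_volume_two_mul_lt_dyadicMaximal_le {D : ℝ} (hD : 0 < D) (F : E → ℝ≥0∞) (c : ℝ≥0∞) :
    c * volume {x | 2 * c < dyadicMaximal D F x} ≤
      ENNReal.ofReal (5 ^ Module.finrank ℝ E) * ∫⁻ x, {y | c < F y}.indicator F x := by
  refine le_trans ?_ (mul_volume_lt_dyadicMaximal_le hD ({y | c < F y}.indicator F) c)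
  refine mul_le_mul_right (measure_mono fun x hx => ?_) _
  obtain ⟨k, hk⟩ := lt_iSup_iff.1 (show 2 * c < ⨆ k, ballAvg D F k x from hx)
  change c < dyadicMaximal D ({y | c < F y}.indicator F) x
  refine lt_of_lt_of_le ?_ (ballAvg_le_dyadicMaximal D _ k x)
  have h : ballAvg D F k x ≤ c + ballAvg D ({y | c < F y}.indicator F) k x := by
    rw [← ballAvg_const_add hD]
    refine ballAvg_mono D (fun y => ?_) k x
    by_cases hy : c < F y
    · rw [indicator_of_mem (by exact hy)]
      exact le_add_self
    · exact (not_lt.1 hy).trans le_self_add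
  have h2 := hk.trans_le h
  rw [two_mul] at h2
  exact lt_of_add_lt_add_left h2

namespace HasGrowthBetween

variable {A : ℝ → ℝ} {l m : ℝ}

lemma continuous_comp_abs (hA : HasGrowthBetween A l m) : Continuous fun s => A |s| :=
  hA.continuousOn.comp_continuous continuous_abs fun x => abs_nonneg x

lemma measurable_comp (hA : HasGrowthBetween A l m) {f : E → ℝ} (hf : Measurable f)
    (hf0 : ∀ x, 0 ≤ f x) : Measurable fun x => A (f x) := by
  have h := hA.continuous_comp_abs.measurable.comp hf
  simpa only [Function.comp_def, abs_of_nonneg (hf0 _)] using h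

lemma lintegral_div_sq_le (hA : HasGrowthBetween A l m) (hl : 1 < l) {a : ℝ} (ha : 0 < a) :
    ENNReal.ofReal a * ∫⁻ s in Ioo 0 (4 * a), ENNReal.ofReal (4 / s * (A |s| / s)) ≤
      ENNReal.ofReal (4 ^ m / (l - 1)) * ENNReal.ofReal (A a) := by
  have hl' : 0 < l - 1 := by linarith
  have hA4 := hA.pos (4 * a) (by linarith)
  set c := 4 * (A (4 * a) / (4 * a) ^ l) with hc
  have hc0 : 0 ≤ c := by positivity
  have hint : IntervalIntegrable (fun s : ℝ => c * s ^ (l - 2)) volume 0 (4 * a) :=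
    (intervalIntegral.intervalIntegrable_rpow' (by linarith)).const_mul c
  have hval : ∫ s in (0 : ℝ)..4 * a, c * s ^ (l - 2) = A (4 * a) / (a * (l - 1)) := by
    rw [intervalIntegral.integral_const_mul, integral_rpow (Or.inl (by linarith)),
      show l - 2 + 1 = l - 1 by ring, Real.zero_rpow hl'.ne', hc,
      Real.rpow_sub (by positivity : 0 < 4 * a), Real.rpow_one]
    have : (4 * a) ^ l ≠ 0 := (Real.rpow_pos_of_pos (by positivity) _).ne'
    field_simp
    ring
  have hle : ∫⁻ s in Ioo 0 (4 * a), ENNReal.ofReal (4 / s * (A |s| / s)) ≤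
      ENNReal.ofReal (A (4 * a) / (a * (l - 1))) := by
    rw [← hval, intervalIntegral.integral_of_le (by positivity),
      ofReal_integral_eq_lintegral_ofReal hint.1]
    · refine (lintegral_mono_set Ioo_subset_Ioc_self).trans ?_
      refine setLIntegral_mono_ae' measurableSet_Ioc (ae_of_all _ fun s hs => ?_)
      have hs0 : 0 < s := hs.1
      refine ENNReal.ofReal_le_ofReal ?_
      rw [abs_of_pos hs0]
      have h := hA.le_rpow_mul s (4 * a) hs0 hs.2
      rw [Real.div_rpow hs0.le (by positivity)] at h
      rw [Real.rpow_sub hs0, Real.rpow_two]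
      calc 4 / s * (A s / s) ≤ 4 / s * (s ^ l / (4 * a) ^ l * A (4 * a) / s) := by gcongr
        _ = c * (s ^ l / s ^ 2) := by rw [hc]; field_simp
    · rw [EventuallyLE, ae_restrict_iff' measurableSet_Ioc]
      exact ae_of_all _ fun s hs => mul_nonneg hc0 (Real.rpow_nonneg hs.1.le _)
  refine (mul_le_mul_right hle _).trans ?_
  rw [← ENNReal.ofReal_mul ha.le, ← ENNReal.ofReal_mul (by positivity)]
  refine ENNReal.ofReal_le_ofReal ?_
  have h := hA.mul_le_rpow (by norm_num : (1 : ℝ) ≤ 4) ha.le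
  calc a * (A (4 * a) / (a * (l - 1))) = A (4 * a) / (l - 1) := by field_simp
    _ ≤ 4 ^ m * A a / (l - 1) := by gcongr
    _ = _ := by ring

/-- The modular maximal inequality `∫ A(M f) ≤ C ∫ A(f)`, valid because the lower growth exponent
exceeds `1`. Since `M f` may be infinite at some points, `A(M f)` is represented by a function `H`
that dominates `A t` for every real `t ≤ M f`. -/
lemma exists_maximal_modular (hA : HasGrowthBetween A l m) (hl : 1 < l) {D : ℝ} (hD : 0 < D)
    {f : E → ℝ} (hf : Measurable f) (hf0 : ∀ x, 0 ≤ f x) :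
    ∃ H : E → ℝ≥0∞, Measurable H ∧
      (∀ x t, 0 ≤ t → ENNReal.ofReal t ≤ dyadicMaximal D (fun y => ENNReal.ofReal (f y)) x →
        ENNReal.ofReal (A t) ≤ H x) ∧
      ∫⁻ x, H x ≤ ENNReal.ofReal (5 ^ Module.finrank ℝ E) *
        ENNReal.ofReal (4 ^ m / (l - 1)) * ∫⁻ x, ENNReal.ofReal (A (f x)) := by
  set F : E → ℝ≥0∞ := fun y => ENNReal.ofReal (f y)
  have hF : Measurable F := hf.ennreal_ofReal
  set M := dyadicMaximal D F
  have hM : Measurable M := measurable_dyadicMaximal hF D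
  have hw : Measurable fun s : ℝ => A |s| / s := hA.continuous_comp_abs.measurable.div measurable_id
  set S : Set (E × ℝ) := {p | ENNReal.ofReal p.2 < 2 * M p.1}
  have hS : MeasurableSet S := measurableSet_lt (by fun_prop) (by fun_prop)
  set h : E × ℝ → ℝ≥0∞ := S.indicator fun p => ENNReal.ofReal (A |p.2| / p.2)
  have hh : Measurable h := (hw.comp measurable_snd).ennreal_ofReal.indicator hS
  refine ⟨fun x => ∫⁻ s in Ioi 0, h (x, s), hh.lintegral_prod_right', ?_, ?_⟩
  · intro x t ht hxt
    rcases eq_or_lt_of_le ht with rfl | ht'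
    · simp [hA.zero]
    calc ENNReal.ofReal (A t) = ∫⁻ _ in Ioo t (2 * t), ENNReal.ofReal (A t / t) := by
          rw [setLIntegral_const, Real.volume_Ioo, ← ENNReal.ofReal_mul
            (div_nonneg (hA.nonneg ht) ht)]
          congr 1
          field_simp
          ring
      _ ≤ ∫⁻ s in Ioo t (2 * t), h (x, s) := by
          refine setLIntegral_mono_ae' measurableSet_Ioo (ae_of_all _ fun s hs => ?_)
          have hs0 : 0 < s := ht'.trans hs.1
          have hmem : (x, s) ∈ S := by
            change ENNReal.ofReal s < 2 * M x
            refine lt_of_lt_of_le ?_ (mul_le_mul_right hxt 2)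
            rw [← ENNReal.ofReal_ofNat, ← ENNReal.ofReal_mul (by norm_num)]
            exact (ENNReal.ofReal_lt_ofReal_iff (by positivity)).2 hs.2
          simp only [h, indicator_of_mem hmem, abs_of_pos hs0]
          refine ENNReal.ofReal_le_ofReal ?_
          have := hA.le_div_mul hl.le ht hs.1.le
          rw [div_le_div_iff₀ ht' hs0]
          rw [div_mul_eq_mul_div, le_div_iff₀ hs0] at this
          linarith
      _ ≤ _ := lintegral_mono_set fun s hs => ht'.trans hs.1
  · rw [lintegral_lintegral_swap (f := fun x s => h (x, s)) hh.aemeasurable]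
    set T : Set (E × ℝ) := {p | ENNReal.ofReal (p.2 / 4) < F p.1}
    have hT : MeasurableSet T := measurableSet_lt (by fun_prop) (by fun_prop)
    set g : E → ℝ → ℝ≥0∞ := fun x s =>
      T.indicator (fun p => ENNReal.ofReal (4 / p.2 * (A |p.2| / p.2)) * F p.1) (x, s)
    have hg : Measurable (Function.uncurry g) := by
      refine Measurable.indicator ?_ hT
      refine Measurable.mul ?_ (hF.comp measurable_fst)
      exact ((measurable_const.div measurable_snd).mul (hw.comp measurable_snd)).ennreal_ofReal
    have hlevel : ∀ s ∈ Ioi (0 : ℝ), ∫⁻ x, h (x, s) ≤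
        ENNReal.ofReal (5 ^ Module.finrank ℝ E) * ∫⁻ x, g x s := by
      intro s hs
      have hs0 : 0 < s := hs
      set w := ENNReal.ofReal (A |s| / s)
      have hset : {x | ENNReal.ofReal s < 2 * M x} = {x | 2 * ENNReal.ofReal (s / 4) < M x} := by
        ext x
        have h2 : ENNReal.ofReal s = 2 * (2 * ENNReal.ofReal (s / 4)) := by
          rw [← ENNReal.ofReal_ofNat, ← ENNReal.ofReal_mul (by norm_num),
            ← ENNReal.ofReal_mul (by norm_num)]
          congr 1
          ring
        change ENNReal.ofReal s < 2 * M x ↔ 2 * ENNReal.ofReal (s / 4) < M x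
        rw [h2, ENNReal.mul_lt_mul_iff_right (by norm_num) (by norm_num)]
      have e1 : ∫⁻ x, h (x, s) = w * volume {x | 2 * ENNReal.ofReal (s / 4) < M x} := by
        rw [← hset, ← lintegral_indicator_const (measurableSet_lt measurable_const (by fun_prop))]
        rfl
      have e2 : ∫⁻ x, g x s = ENNReal.ofReal (4 / s) * w *
          ∫⁻ x, {y | ENNReal.ofReal (s / 4) < F y}.indicator F x := by
        rw [← lintegral_const_mul _
          (hF.indicator (measurableSet_lt measurable_const hF))]
        refine lintegral_congr fun x => ?_
        simp only [g, w]
        by_cases hx : ENNReal.ofReal (s / 4) < F x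
        · rw [indicator_of_mem (by exact hx), indicator_of_mem (by exact hx)]
          change ENNReal.ofReal (4 / s * (A |s| / s)) * F x = _
          rw [ENNReal.ofReal_mul (by positivity)]
        · rw [indicator_of_notMem (by exact hx), indicator_of_notMem (by exact hx), mul_zero]
      have hwt := mul_volume_two_mul_lt_dyadicMaximal_le hD F (ENNReal.ofReal (s / 4))
      have hone : ENNReal.ofReal (4 / s) * ENNReal.ofReal (s / 4) = 1 := by
        rw [← ENNReal.ofReal_mul (by positivity), show 4 / s * (s / 4) = 1 by field_simp,
          ENNReal.ofReal_one]
      rw [e1, e2]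
      calc w * volume {x | 2 * ENNReal.ofReal (s / 4) < M x}
          = ENNReal.ofReal (4 / s) * w *
            (ENNReal.ofReal (s / 4) * volume {x | 2 * ENNReal.ofReal (s / 4) < M x}) := by
            rw [← one_mul (w * _), ← hone]
            ring
        _ ≤ ENNReal.ofReal (4 / s) * w * (ENNReal.ofReal (5 ^ Module.finrank ℝ E) *
              ∫⁻ x, {y | ENNReal.ofReal (s / 4) < F y}.indicator F x) := by gcongr
        _ = _ := by ring
    have hg' : Measurable fun s => ∫⁻ x, g x s :=
      Measurable.lintegral_prod_left' (f := Function.uncurry g) hg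
    calc ∫⁻ s in Ioi 0, ∫⁻ x, h (x, s)
        ≤ ∫⁻ s in Ioi 0, ENNReal.ofReal (5 ^ Module.finrank ℝ E) * ∫⁻ x, g x s :=
          setLIntegral_mono_ae' measurableSet_Ioi (ae_of_all _ hlevel)
      _ = ENNReal.ofReal (5 ^ Module.finrank ℝ E) * ∫⁻ x, ∫⁻ s in Ioi 0, g x s := by
          rw [lintegral_const_mul _ hg', lintegral_lintegral_swap hg.aemeasurable]
      _ ≤ ENNReal.ofReal (5 ^ Module.finrank ℝ E) *
            ∫⁻ x, ENNReal.ofReal (4 ^ m / (l - 1)) * ENNReal.ofReal (A (f x)) := by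
          gcongr with x
          rcases eq_or_lt_of_le (hf0 x) with h0 | h0
          · have hz : ∀ s, g x s = 0 := by
              intro s
              refine indicator_of_notMem ?_ _
              change ¬ ENNReal.ofReal (s / 4) < ENNReal.ofReal (f x)
              simp [← h0]
            simp [hz]
          · refine le_trans (le_of_eq ?_) (hA.lintegral_div_sq_le hl h0)
            rw [← lintegral_const_mul _ (by fun_prop), ← lintegral_indicator measurableSet_Ioi,
              ← lintegral_indicator measurableSet_Ioo]
            refine lintegral_congr fun s => ?_
            by_cases hs : s ∈ Ioi (0 : ℝ)
            · rw [indicator_of_mem hs]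
              have hiff : (x, s) ∈ T ↔ s < 4 * f x := by
                change ENNReal.ofReal (s / 4) < ENNReal.ofReal (f x) ↔ _
                rw [ENNReal.ofReal_lt_ofReal_iff h0]
                constructor <;> intro h <;> linarith
              by_cases hs' : s < 4 * f x
              · rw [indicator_of_mem (show s ∈ Ioo 0 (4 * f x) from ⟨hs, hs'⟩)]
                simp only [g]
                rw [indicator_of_mem (hiff.2 hs'), mul_comm]
              · rw [indicator_of_notMem (fun h => hs' h.2)]
                exact indicator_of_notMem (fun h => hs' (hiff.1 h)) _
            · rw [indicator_of_notMem hs, indicator_of_notMem (fun h => hs h.1)]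
      _ = _ := by
          rw [lintegral_const_mul _ (hA.measurable_comp hf hf0).ennreal_ofReal, mul_assoc]

/-- A Jensen-type inequality for ball averages, up to the additive term `b`. -/
lemma ballAvg_le_add (hA : HasGrowthBetween A l m) (hl : 1 ≤ l) {D : ℝ} (hD : 0 < D)
    {f : E → ℝ} (hf : Measurable f) (hf0 : ∀ x, 0 ≤ f x) {b : ℝ} (hb : 0 < b) (k : ℕ) (x : E) :
    ballAvg D (fun y => ENNReal.ofReal (f y)) k x ≤ ENNReal.ofReal b +
      ENNReal.ofReal (b / A b) * ballAvg D (fun y => ENNReal.ofReal (A (f y))) k x := by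
  have hAb := hA.pos b hb
  rw [← ballAvg_const_mul (hA.measurable_comp hf hf0).ennreal_ofReal, ← ballAvg_const_add hD]
  refine ballAvg_mono D (fun y => ?_) k x
  rw [← ENNReal.ofReal_mul (by positivity), ← ENNReal.ofReal_add hb.le
    (mul_nonneg (by positivity) (hA.nonneg (hf0 y)))]
  exact ENNReal.ofReal_le_ofReal (hA.le_add_mul hl hb (hf0 y))

/-- The Orlicz–Sobolev bound for the dyadic Riesz potential: `∑ 2 ^ (-k) ⨍ f` over the balls of
radius `D 2 ^ (-k)` is at most `C G_A(A(M f))`. -/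
lemma tsum_ballAvg_le (hA : HasGrowthBetween A l m) (hl : 1 ≤ l) (hm : 0 < m)
    (hd : 0 < Module.finrank ℝ E) (hmd : m < Module.finrank ℝ E) {D : ℝ} (hD : 0 < D)
    {Λ : ℝ} (hΛ : 0 < Λ) : ∃ C : ℝ, 0 < C ∧ ∀ f : E → ℝ, Measurable f → (∀ x, 0 ≤ f x) →
      ∫⁻ x, ENNReal.ofReal (A (f x)) ≤ ENNReal.ofReal Λ → ∀ x μ, 0 ≤ μ →
        dyadicMaximal D (fun y => ENNReal.ofReal (f y)) x ≤ ENNReal.ofReal μ →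
        ∑' k, 2⁻¹ ^ k * ballAvg D (fun y => ENNReal.ofReal (f y)) k x ≤
          ENNReal.ofReal (C * sobolevG (Module.finrank ℝ E) A (A μ)) := by
  set d := Module.finrank ℝ E
  set V := (volume (Metric.closedBall (0 : E) D)).toReal
  have hV : 0 < V := ENNReal.toReal_pos (Metric.measure_closedBall_pos _ _ hD).ne'
    measure_closedBall_lt_top.ne
  set κ := Λ / V
  have hκ : 0 < κ := div_pos hΛ hV
  refine ⟨24 * κ ^ (1 / (d : ℝ)), by positivity, fun f hf hf0 hfΛ x μ hμ hM => ?_⟩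
  set F : E → ℝ≥0∞ := fun y => ENNReal.ofReal (f y)
  have hvol : ∀ k, volume (Metric.closedBall (0 : E) (D * 2⁻¹ ^ k)) =
      ENNReal.ofReal ((2⁻¹ ^ k) ^ d * V) := by
    intro k
    rw [mul_comm D, Measure.addHaar_closedBall_mul _ _ (by positivity) hD.le,
      ENNReal.ofReal_mul (by positivity), ENNReal.ofReal_toReal measure_closedBall_lt_top.ne]
  have hle : ∀ k, ballAvg D F k x ≤ ENNReal.ofReal μ := fun k =>
    (ballAvg_le_dyadicMaximal D F k x).trans hM
  have hfin : ∀ k, ballAvg D F k x ≠ ∞ := fun k => ((hle k).trans_lt ENNReal.ofReal_lt_top).ne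
  have hle' : ∀ k, ballAvg D F k x ≤ ENNReal.ofReal (2 * halfLineInv A (κ * 2 ^ (k * d))) := by
    intro k
    have hσ : 0 < κ * 2 ^ (k * d) := by positivity
    set b := halfLineInv A (κ * 2 ^ (k * d))
    have hb : 0 < b := hA.inv_pos hl hσ
    have hAb : A b = κ * 2 ^ (k * d) := hA.apply_inv hl hσ.le
    refine (hA.ballAvg_le_add hl hD hf hf0 hb k x).trans ?_
    have h1 : ballAvg D (fun y => ENNReal.ofReal (A (f y))) k x ≤ ENNReal.ofReal (A b) := by
      rw [ballAvg, hvol]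
      refine ENNReal.div_le_of_le_mul ?_
      rw [hAb, ← ENNReal.ofReal_mul hσ.le]
      refine (setLIntegral_le_lintegral _ _).trans (hfΛ.trans (ENNReal.ofReal_le_ofReal ?_))
      rw [← pow_mul, inv_pow]
      simp only [κ]
      field_simp
      exact le_rfl
    calc ENNReal.ofReal b + ENNReal.ofReal (b / A b) * _
        ≤ ENNReal.ofReal b + ENNReal.ofReal (b / A b) * ENNReal.ofReal (A b) := by gcongr
      _ = ENNReal.ofReal (2 * b) := by
        have := hA.pos b hb
        rw [← ENNReal.ofReal_mul (by positivity), div_mul_cancel₀ _ this.ne',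
          ← ENNReal.ofReal_add hb.le hb.le, two_mul]
  rw [ENNReal.tsum_eq_iSup_nat]
  refine iSup_le fun n => ?_
  have hsum := hA.sum_le_sobolevG hl hm hd hmd hκ hμ (a := fun k => (ballAvg D F k x).toReal)
    (fun k => ENNReal.toReal_le_of_le_ofReal hμ (hle k))
    (fun k => ENNReal.toReal_le_of_le_ofReal
      (mul_nonneg zero_le_two (hA.inv_nonneg hl (by positivity))) (hle' k)) n
  refine le_trans (le_of_eq ?_) (ENNReal.ofReal_le_ofReal hsum)
  rw [ENNReal.ofReal_sum_of_nonneg fun k _ => by positivity]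
  refine Finset.sum_congr rfl fun k _ => ?_
  rw [ENNReal.ofReal_mul (by positivity), ENNReal.ofReal_toReal (hfin k),
    ENNReal.ofReal_pow (by norm_num), ENNReal.ofReal_inv_of_pos (by norm_num),
    ENNReal.ofReal_ofNat]

end HasGrowthBetween

end Maximal

/-! ### Averages along a cone and the weak gradient -/

section ConeAverage

variable {N : ℕ}

lemma integrable_mul_of_tsupport_subset {U : Set (EuclideanSpace ℝ (Fin N))}
    {u ψ : EuclideanSpace ℝ (Fin N) → ℝ} (hu : LocallyIntegrableOn u U volume)
    (hψ : Continuous ψ) (hc : HasCompactSupport ψ) (hs : tsupport ψ ⊆ U) :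
    Integrable (fun z => u z * ψ z) := by
  have h1 : IntegrableOn u (tsupport ψ) := hu.integrableOn_compact_subset hs hc
  have h2 : IntegrableOn (fun z => u z * ψ z) (tsupport ψ) :=
    h1.mul_continuousOn hψ.continuousOn hc
  refine (integrableOn_iff_integrable_of_support_subset fun z hz => ?_).1 h2
  exact subset_tsupport _ (right_ne_zero_of_mul hz)

lemma integrable_inner_mul_of_tsupport_subset {U : Set (EuclideanSpace ℝ (Fin N))}
    {g : EuclideanSpace ℝ (Fin N) → EuclideanSpace ℝ (Fin N)}
    {ψ : EuclideanSpace ℝ (Fin N) → ℝ} (hg : LocallyIntegrableOn g U volume)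
    (hψ : Continuous ψ) (hc : HasCompactSupport ψ) (hs : tsupport ψ ⊆ U)
    (e : EuclideanSpace ℝ (Fin N)) : Integrable (fun z => inner ℝ (g z) e * ψ z) := by
  have h1 : IntegrableOn g (tsupport ψ) := hg.integrableOn_compact_subset hs hc
  have h2 : IntegrableOn (fun z => inner ℝ (g z) e * ψ z) (tsupport ψ) :=
    IntegrableOn.mul_continuousOn (Integrable.inner_const h1 e) hψ.continuousOn hc
  refine (integrableOn_iff_integrable_of_support_subset fun z hz => ?_).1 h2
  exact subset_tsupport _ (right_ne_zero_of_mul hz)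

/-- The average of `u` over `U` against the rescaled kernel `t ^ (-N) η((z - x) / t)`. -/
noncomputable def kernelAvg (U : Set (EuclideanSpace ℝ (Fin N)))
    (u η : EuclideanSpace ℝ (Fin N) → ℝ) (x : EuclideanSpace ℝ (Fin N)) (t : ℝ) : ℝ :=
  ∫ z in U, u z * ((t ^ N)⁻¹ * η (t⁻¹ • (z - x)))

/-- The radial derivative `N η(w) + Dη(w) w`, that is the divergence of `w ↦ η(w) w`. -/
noncomputable def radialDiv (η : EuclideanSpace ℝ (Fin N) → ℝ)
    (w : EuclideanSpace ℝ (Fin N)) : ℝ :=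
  N * η w + fderiv ℝ η w w

lemma hasDerivAt_kernel {η : EuclideanSpace ℝ (Fin N) → ℝ} (hη : ContDiff ℝ (⊤ : ℕ∞) η)
    (y : EuclideanSpace ℝ (Fin N)) {t : ℝ} (ht : 0 < t) :
    HasDerivAt (fun t : ℝ => (t ^ N)⁻¹ * η (t⁻¹ • y))
      (-((t ^ (N + 1))⁻¹ * radialDiv η (t⁻¹ • y))) t := by
  have h1 : HasDerivAt (fun t : ℝ => (t ^ N)⁻¹) (-(N * t ^ (N - 1)) / (t ^ N) ^ 2) t :=
    (hasDerivAt_pow N t).fun_inv (pow_ne_zero _ ht.ne')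
  have h2 : HasDerivAt (fun t : ℝ => t⁻¹ • y) ((-(t ^ 2)⁻¹) • y) t :=
    (hasDerivAt_inv ht.ne').smul_const y
  have h3 : HasDerivAt (fun t : ℝ => η (t⁻¹ • y)) (fderiv ℝ η (t⁻¹ • y) ((-(t ^ 2)⁻¹) • y)) t :=
    ((hη.differentiable (by simp)) _).hasFDerivAt.comp_hasDerivAt t h2
  refine (h1.fun_mul h3).congr_deriv ?_
  simp only [radialDiv, map_smul, smul_eq_mul]
  rcases N with _ | N
  · simp
    field_simp
  · simp only [Nat.add_sub_cancel]
    field_simp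
    ring

lemma tsupport_kernel_subset {η : EuclideanSpace ℝ (Fin N) → ℝ}
    {x : EuclideanSpace ℝ (Fin N)} {t : ℝ} {z : EuclideanSpace ℝ (Fin N)}
    {ψ : EuclideanSpace ℝ (Fin N) → ℝ} (hψ : ∀ z, η (t⁻¹ • (z - x)) = 0 → ψ z = 0)
    (hz : z ∈ tsupport ψ) : t⁻¹ • (z - x) ∈ tsupport η := by
  have hcl : IsClosed ((fun z => t⁻¹ • (z - x)) ⁻¹' tsupport η) :=
    (isClosed_tsupport η).preimage (by fun_prop)
  refine hcl.closure_subset_iff.2 (fun z hz => ?_) hz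
  exact subset_tsupport _ fun h => hz (hψ z h)

lemma hasCompactSupport_kernel {η : EuclideanSpace ℝ (Fin N) → ℝ} (hc : HasCompactSupport η)
    {x : EuclideanSpace ℝ (Fin N)} {t : ℝ} (ht : 0 < t)
    {ψ : EuclideanSpace ℝ (Fin N) → ℝ} (hψ : ∀ z, η (t⁻¹ • (z - x)) = 0 → ψ z = 0) :
    HasCompactSupport ψ := by
  have hK : IsCompact ((fun y => x + t • y) '' tsupport η) :=
    IsCompact.image hc (by fun_prop)
  refine HasCompactSupport.intro' hK hK.isClosed fun z hz => ?_
  by_contra h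
  refine hz ⟨t⁻¹ • (z - x), tsupport_kernel_subset hψ (subset_tsupport _ h), ?_⟩
  simp only [smul_inv_smul₀ ht.ne', add_sub_cancel]

/-- The weak gradient tested against the vector field `z ↦ η((z - x) / t) (z - x)`. -/
lemma integral_mul_radialDiv {U : Set (EuclideanSpace ℝ (Fin N))}
    {u : EuclideanSpace ℝ (Fin N) → ℝ}
    {g : EuclideanSpace ℝ (Fin N) → EuclideanSpace ℝ (Fin N)} (hug : IsWeakGradient U u g)
    {η : EuclideanSpace ℝ (Fin N) → ℝ} (hη : ContDiff ℝ (⊤ : ℕ∞) η) (hc : HasCompactSupport η)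
    {x : EuclideanSpace ℝ (Fin N)} {t : ℝ} (ht : 0 < t)
    (hU : ∀ y ∈ tsupport η, x + t • y ∈ U) :
    ∫ z in U, u z * radialDiv η (t⁻¹ • (z - x)) =
      -∫ z in U, inner ℝ (g z) (z - x) * η (t⁻¹ • (z - x)) := by
  set b := EuclideanSpace.basisFun (Fin N) ℝ
  set ψ : Fin N → EuclideanSpace ℝ (Fin N) → ℝ := fun i z =>
    inner ℝ (b i) (z - x) * η (t⁻¹ • (z - x)) with hψ_def
  have hψs : ∀ i, ContDiff ℝ (⊤ : ℕ∞) (ψ i) := fun i => by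
    refine ContDiff.mul ?_ (hη.comp (by fun_prop))
    exact contDiff_const.inner ℝ (by fun_prop)
  have hz : ∀ i z, η (t⁻¹ • (z - x)) = 0 → ψ i z = 0 := fun i z h => by simp [hψ_def, h]
  have hψc : ∀ i, HasCompactSupport (ψ i) := fun i => hasCompactSupport_kernel hc ht (hz i)
  have hψU : ∀ i, tsupport (ψ i) ⊆ U := fun i z hzz => by
    have := hU _ (tsupport_kernel_subset (hz i) hzz)
    rwa [smul_inv_smul₀ ht.ne', add_sub_cancel] at this
  have hderiv : ∀ i z, fderiv ℝ (ψ i) z (b i) = η (t⁻¹ • (z - x)) +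
      inner ℝ (b i) (z - x) * fderiv ℝ η (t⁻¹ • (z - x)) (t⁻¹ • b i) := by
    intro i z
    have h1 : HasFDerivAt (fun z => inner ℝ (b i) (z - x)) (innerSL ℝ (b i)) z := by
      have := (innerSL ℝ (b i)).hasFDerivAt.comp z ((hasFDerivAt_id z).sub_const x)
      simpa [Function.comp_def] using this
    have h2 : HasFDerivAt (fun z => t⁻¹ • (z - x))
        (t⁻¹ • ContinuousLinearMap.id ℝ (EuclideanSpace ℝ (Fin N))) z :=
      ((hasFDerivAt_id z).sub_const x).const_smul t⁻¹
    have h3 := ((hη.differentiable (by simp)) (t⁻¹ • (z - x))).hasFDerivAt.comp z h2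
    have h4 := h1.mul h3
    rw [show ψ i = (fun z => inner ℝ (b i) (z - x)) * (η ∘ fun z => t⁻¹ • (z - x)) from rfl,
      h4.fderiv]
    simp only [Function.comp_apply, add_apply, smul_apply,
      ContinuousLinearMap.comp_apply, ContinuousLinearMap.id_apply, innerSL_apply_apply, smul_eq_mul,
      real_inner_self_eq_norm_sq, b.norm_eq_one]
    ring
  have hsum : ∀ z, radialDiv η (t⁻¹ • (z - x)) = ∑ i, fderiv ℝ (ψ i) z (b i) := by
    intro z
    simp only [hderiv]
    rw [Finset.sum_add_distrib, Finset.sum_const, Finset.card_univ, Fintype.card_fin, nsmul_eq_mul,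
      radialDiv]
    congr 1
    have : t⁻¹ • (z - x) = ∑ i, inner ℝ (b i) (z - x) • t⁻¹ • b i := by
      conv_lhs => rw [← b.sum_repr' (z - x)]
      rw [Finset.smul_sum]
      exact Finset.sum_congr rfl fun i _ => smul_comm _ _ _
    conv_lhs => rw [show fderiv ℝ η (t⁻¹ • (z - x)) (t⁻¹ • (z - x)) =
      fderiv ℝ η (t⁻¹ • (z - x)) (∑ i, inner ℝ (b i) (z - x) • t⁻¹ • b i) by rw [← this]]
    rw [map_sum]
    exact Finset.sum_congr rfl fun i _ => by rw [map_smul, smul_eq_mul]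
  have hint1 : ∀ i, Integrable (fun z => u z * fderiv ℝ (ψ i) z (b i)) (volume.restrict U) := by
    intro i
    refine (integrable_mul_of_tsupport_subset hug.locallyIntegrable
      (((hψs i).continuous_fderiv (by simp)).clm_apply continuous_const)
      ((hψc i).fderiv_apply ℝ (b i)) ?_).restrict
    exact (tsupport_fderiv_apply_subset ℝ (b i)).trans (hψU i)
  have hint2 : ∀ i, Integrable (fun z => inner ℝ (g z) (b i) * ψ i z) (volume.restrict U) :=
    fun i => (integrable_inner_mul_of_tsupport_subset hug.locallyIntegrable_grad
      (hψs i).continuous (hψc i) (hψU i) (b i)).restrict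
  calc ∫ z in U, u z * radialDiv η (t⁻¹ • (z - x))
      = ∫ z in U, ∑ i, u z * fderiv ℝ (ψ i) z (b i) := by
        simp only [hsum, Finset.mul_sum]
    _ = ∑ i, ∫ z in U, u z * fderiv ℝ (ψ i) z (b i) := integral_finsetSum _ fun i _ => hint1 i
    _ = ∑ i, -∫ z in U, inner ℝ (g z) (b i) * ψ i z :=
        Finset.sum_congr rfl fun i _ => hug.integral_eq _ (hψs i) (hψc i) (hψU i) _
    _ = -∫ z in U, ∑ i, inner ℝ (g z) (b i) * ψ i z := by
        rw [Finset.sum_neg_distrib, integral_finsetSum _ fun i _ => hint2 i]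
    _ = _ := by
        congr 2
        ext z
        rw [← b.sum_inner_mul_inner (g z) (z - x), Finset.sum_mul]
        exact Finset.sum_congr rfl fun i _ => by simp only [hψ_def]; ring

/-- The derivative of `t ↦ kernelAvg U u η x t` only involves the weak gradient of `u`. -/
lemma hasDerivAt_kernelAvg {U : Set (EuclideanSpace ℝ (Fin N))}
    {u : EuclideanSpace ℝ (Fin N) → ℝ}
    {g : EuclideanSpace ℝ (Fin N) → EuclideanSpace ℝ (Fin N)} (hug : IsWeakGradient U u g)
    {η : EuclideanSpace ℝ (Fin N) → ℝ} (hη : ContDiff ℝ (⊤ : ℕ∞) η) (hc : HasCompactSupport η)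
    {x : EuclideanSpace ℝ (Fin N)} {T : ℝ}
    (hU : ∀ t, 0 < t → t < T → ∀ y ∈ tsupport η, x + t • y ∈ U) {t₀ : ℝ} (ht₀ : 0 < t₀)
    (ht₀T : t₀ < T) :
    HasDerivAt (kernelAvg U u η x)
      ((t₀ ^ (N + 1))⁻¹ * ∫ z in U, inner ℝ (g z) (z - x) * η (t₀⁻¹ • (z - x))) t₀ := by
  obtain ⟨t₁, ht₁, ht₁T⟩ := exists_between ht₀T
  have hPc : Continuous (radialDiv η) :=
    (continuous_const.mul hη.continuous).add
      ((hη.continuous_fderiv (by simp)).clm_apply continuous_id)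
  have hP0 : ∀ w, w ∉ tsupport η → radialDiv η w = 0 := by
    intro w hw
    have h1 : η w = 0 := image_eq_zero_of_notMem_tsupport hw
    have h2 : fderiv ℝ η w = 0 :=
      image_eq_zero_of_notMem_tsupport fun h => hw (tsupport_fderiv_subset ℝ h)
    simp [radialDiv, h1, h2]
  have hPs : HasCompactSupport (radialDiv η) := HasCompactSupport.intro hc hP0
  obtain ⟨Cp, hCp⟩ := hPs.exists_bound_of_continuous hPc
  set K : Set (EuclideanSpace ℝ (Fin N)) :=
    (fun p : ℝ × EuclideanSpace ℝ (Fin N) => x + p.1 • p.2) '' (Icc (t₀ / 2) t₁ ×ˢ tsupport η)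
  have hK : IsCompact K := (isCompact_Icc.prod hc).image (by fun_prop)
  have hKU : K ⊆ U := by
    rintro _ ⟨⟨t, y⟩, ⟨ht, hy⟩, rfl⟩
    exact hU t (by have := ht.1; dsimp at this; linarith)
      (by have := ht.2; dsimp at this; linarith) y hy
  have hKP : ∀ t ∈ Ioo (t₀ / 2) t₁, ∀ z, z ∉ K → radialDiv η (t⁻¹ • (z - x)) = 0 := by
    intro t ht z hz
    refine hP0 _ fun h => hz ⟨(t, t⁻¹ • (z - x)), ⟨⟨ht.1.le, ht.2.le⟩, h⟩, ?_⟩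
    have : t ≠ 0 := by have := ht.1; intro h; linarith
    simp [smul_inv_smul₀ this]
  have hum : AEStronglyMeasurable u (volume.restrict U) :=
    hug.locallyIntegrable.aestronglyMeasurable
  have hkc : ∀ t : ℝ, Continuous fun z => (t ^ N)⁻¹ * η (t⁻¹ • (z - x)) := fun t =>
    continuous_const.mul (hη.continuous.comp (by fun_prop))
  have hbound : Integrable (K.indicator fun z => ‖u z‖ * (((t₀ / 2) ^ (N + 1))⁻¹ * Cp))
      (volume.restrict U) := by
    have h : IntegrableOn u K := hug.locallyIntegrable.integrableOn_compact_subset hKU hK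
    have h' : IntegrableOn (fun z => ‖u z‖ * (((t₀ / 2) ^ (N + 1))⁻¹ * Cp)) K :=
      Integrable.mul_const (Integrable.norm h) _
    exact (h'.integrable_indicator hK.measurableSet).restrict
  have key := hasDerivAt_integral_of_dominated_loc_of_deriv_le (𝕜 := ℝ)
    (μ := volume.restrict U) (s := Ioo (t₀ / 2) t₁)
    (F := fun t z => u z * ((t ^ N)⁻¹ * η (t⁻¹ • (z - x))))
    (F' := fun t z => u z * -((t ^ (N + 1))⁻¹ * radialDiv η (t⁻¹ • (z - x))))
    (bound := K.indicator fun z => ‖u z‖ * (((t₀ / 2) ^ (N + 1))⁻¹ * Cp))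
    (Ioo_mem_nhds (by linarith) ht₁)
    (Eventually.of_forall fun t => hum.mul (hkc t).aestronglyMeasurable)
    ?_ ?_ ?_ hbound ?_
  · refine key.2.congr_deriv ?_
    have h := integral_mul_radialDiv hug hη hc ht₀ (hU t₀ ht₀ ht₀T)
    rw [← neg_eq_iff_eq_neg] at h
    rw [← h, ← integral_neg, ← integral_const_mul]
    exact integral_congr_ae (ae_of_all _ fun z => by ring)
  · have hz : ∀ z, η (t₀⁻¹ • (z - x)) = 0 → (t₀ ^ N)⁻¹ * η (t₀⁻¹ • (z - x)) = 0 :=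
      fun z h => by rw [h, mul_zero]
    refine (integrable_mul_of_tsupport_subset hug.locallyIntegrable (hkc t₀)
      (hasCompactSupport_kernel hc ht₀ hz) fun z hzz => ?_).restrict
    have := hU t₀ ht₀ ht₀T _ (tsupport_kernel_subset hz hzz)
    rwa [smul_inv_smul₀ ht₀.ne', add_sub_cancel] at this
  · refine hum.mul (Continuous.aestronglyMeasurable ?_)
    exact (continuous_const.mul (hPc.comp (by fun_prop))).neg
  · refine ae_of_all _ fun z t ht => ?_
    by_cases hz : z ∈ K
    · rw [indicator_of_mem hz, norm_mul, norm_neg, norm_mul]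
      have ht0 : 0 < t₀ / 2 := by linarith
      have h1 : ‖(t ^ (N + 1))⁻¹‖ ≤ ((t₀ / 2) ^ (N + 1))⁻¹ := by
        have : 0 < t := ht0.trans ht.1
        rw [Real.norm_of_nonneg (by positivity)]
        have := ht.1.le
        gcongr
      gcongr
      exact hCp _
    · rw [indicator_of_notMem hz, hKP t ht z hz]
      simp
  · refine ae_of_all _ fun z t ht => ?_
    exact (hasDerivAt_kernel hη (z - x) (by have := ht.1; linarith)).const_mul (u z)

end ConeAverage

/-! ### The pointwise potential estimate -/

section Potential

variable {N : ℕ}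

lemma volume_dyadicBall_eq {D : ℝ} (hD : 0 < D) (k : ℕ) :
    volume (Metric.closedBall (0 : EuclideanSpace ℝ (Fin N)) (D * 2⁻¹ ^ k)) =
      ENNReal.ofReal ((2⁻¹ ^ k) ^ N *
        volume.real (Metric.closedBall (0 : EuclideanSpace ℝ (Fin N)) D)) := by
  rw [mul_comm D, Measure.addHaar_closedBall_mul _ _ (by positivity) hD.le, finrank_euclideanSpace,
    Fintype.card_fin, ENNReal.ofReal_mul (by positivity), measureReal_def,
    ENNReal.ofReal_toReal measure_closedBall_lt_top.ne]

lemma lintegral_indicator_eq_ballAvg {D : ℝ} (hD : 0 < D) {U : Set (EuclideanSpace ℝ (Fin N))}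
    (hU : MeasurableSet U) (F : EuclideanSpace ℝ (Fin N) → ℝ≥0∞) (k : ℕ)
    (x : EuclideanSpace ℝ (Fin N)) :
    ∫⁻ z in U, (Metric.closedBall x (D * 2⁻¹ ^ k)).indicator F z =
      ballAvg D (U.indicator F) k x * ENNReal.ofReal ((2⁻¹ ^ k) ^ N *
        volume.real (Metric.closedBall (0 : EuclideanSpace ℝ (Fin N)) D)) := by
  rw [← volume_dyadicBall_eq hD, ← setLIntegral_eq_ballAvg_mul hD, ← lintegral_indicator hU,
    ← lintegral_indicator Metric.isClosed_closedBall.measurableSet, indicator_indicator,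
    indicator_indicator, inter_comm]

lemma mem_closedBall_of_kernel_ne_zero {η : EuclideanSpace ℝ (Fin N) → ℝ} {D : ℝ}
    (hηD : tsupport η ⊆ Metric.closedBall 0 D) {x z : EuclideanSpace ℝ (Fin N)} {t : ℝ}
    (ht : 0 < t) (h : η (t⁻¹ • (z - x)) ≠ 0) : ‖z - x‖ ≤ D * t := by
  have h1 : t⁻¹ • (z - x) ∈ Metric.closedBall 0 D := hηD (subset_tsupport _ h)
  rw [mem_closedBall_zero_iff, norm_smul, norm_inv, Real.norm_of_nonneg ht.le,
    inv_mul_le_iff₀ ht] at h1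
  linarith

lemma enorm_kernelAvg_le {U : Set (EuclideanSpace ℝ (Fin N))} (hU : MeasurableSet U)
    (u : EuclideanSpace ℝ (Fin N) → ℝ) {η : EuclideanSpace ℝ (Fin N) → ℝ} {Cη D : ℝ}
    (hCη : ∀ w, ‖η w‖ ≤ Cη) (hD : 0 < D) (hηD : tsupport η ⊆ Metric.closedBall 0 D)
    (x : EuclideanSpace ℝ (Fin N)) (k : ℕ) :
    ‖kernelAvg U u η x (2⁻¹ ^ k)‖ₑ ≤
      ENNReal.ofReal (Cη * volume.real (Metric.closedBall (0 : EuclideanSpace ℝ (Fin N)) D)) *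
        ballAvg D (U.indicator fun z => ‖u z‖ₑ) k x := by
  have hC0 : 0 ≤ Cη := (norm_nonneg _).trans (hCη 0)
  set r : ℝ := 2⁻¹ ^ k with hr
  have hr0 : 0 < r := by positivity
  calc ‖kernelAvg U u η x r‖ₑ
      ≤ ∫⁻ z in U, ‖u z * ((r ^ N)⁻¹ * η (r⁻¹ • (z - x)))‖ₑ := enorm_integral_le_lintegral_enorm _
    _ ≤ ∫⁻ z in U, ENNReal.ofReal ((r ^ N)⁻¹ * Cη) *
          (Metric.closedBall x (D * r)).indicator (fun z => ‖u z‖ₑ) z := by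
        refine lintegral_mono fun z => ?_
        dsimp only
        by_cases h : η (r⁻¹ • (z - x)) = 0
        · simp [h]
        · rw [indicator_of_mem (by
            rw [Metric.mem_closedBall, dist_eq_norm]
            exact mem_closedBall_of_kernel_ne_zero hηD hr0 h), enorm_mul, mul_comm]
          gcongr
          rw [← ofReal_norm]
          refine ENNReal.ofReal_le_ofReal ?_
          rw [norm_mul, Real.norm_of_nonneg (by positivity : 0 ≤ (r ^ N)⁻¹)]
          gcongr
          exact hCη _
    _ = _ := by
        rw [lintegral_const_mul' _ _ ENNReal.ofReal_ne_top, lintegral_indicator_eq_ballAvg hD hU,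
          mul_comm (ballAvg _ _ _ _), ← mul_assoc, ← ENNReal.ofReal_mul (by positivity)]
        congr 2
        rw [← hr]
        field_simp

lemma edist_kernelAvg_le {U : Set (EuclideanSpace ℝ (Fin N))} (hU : MeasurableSet U)
    {u : EuclideanSpace ℝ (Fin N) → ℝ}
    {g : EuclideanSpace ℝ (Fin N) → EuclideanSpace ℝ (Fin N)} (hug : IsWeakGradient U u g)
    {η : EuclideanSpace ℝ (Fin N) → ℝ} (hη : ContDiff ℝ (⊤ : ℕ∞) η) (hc : HasCompactSupport η)
    {Cη D : ℝ} (hCη0 : 0 < Cη) (hCη : ∀ w, ‖η w‖ ≤ Cη) (hD : 0 < D)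
    (hηD : tsupport η ⊆ Metric.closedBall 0 D) {x : EuclideanSpace ℝ (Fin N)}
    (hηU : ∀ t : ℝ, 0 < t → t < 2 → ∀ y ∈ tsupport η, x + t • y ∈ U) (k : ℕ) :
    edist (kernelAvg U u η x (2⁻¹ ^ k)) (kernelAvg U u η x (2⁻¹ ^ (k + 1))) ≤
      ENNReal.ofReal (2 ^ N * D * Cη *
        volume.real (Metric.closedBall (0 : EuclideanSpace ℝ (Fin N)) D)) *
          (2⁻¹ ^ k * ballAvg D (U.indicator fun z => ‖g z‖ₑ) k x) := by
  set V := volume.real (Metric.closedBall (0 : EuclideanSpace ℝ (Fin N)) D)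
  have hV : 0 < V := ENNReal.toReal_pos (Metric.measure_closedBall_pos _ _ hD).ne'
    measure_closedBall_lt_top.ne
  set r : ℝ := 2⁻¹ ^ k with hr
  have hr0 : 0 < r := by positivity
  have hr1 : r ≤ 1 := pow_le_one₀ (by norm_num) (by norm_num)
  have hr2 : (2⁻¹ : ℝ) ^ (k + 1) = r / 2 := by rw [pow_succ, hr]; ring
  have hrE : (2⁻¹ : ℝ≥0∞) ^ k = ENNReal.ofReal r := by
    rw [hr, ENNReal.ofReal_pow (by norm_num), ENNReal.ofReal_inv_of_pos (by norm_num),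
      ENNReal.ofReal_ofNat]
  set a := ballAvg D (U.indicator fun z => ‖g z‖ₑ) k x with ha_def
  rw [hr2, hrE]
  rcases eq_or_ne a ∞ with ha | ha
  · rw [ha, ENNReal.mul_top (by simpa using hr0), ENNReal.mul_top (by simp; positivity)]
    exact le_top
  have hderiv : ∀ t ∈ Icc (r / 2) r,
      ‖(t ^ (N + 1))⁻¹ * ∫ z in U, inner ℝ (g z) (z - x) * η (t⁻¹ • (z - x))‖ ≤
        2 ^ N * D * Cη * V * a.toReal := by
    intro t ht
    have ht0 : 0 < t := by linarith [ht.1]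
    have hJ : ‖∫ z in U, inner ℝ (g z) (z - x) * η (t⁻¹ • (z - x))‖ₑ ≤
        ENNReal.ofReal (D * t * Cη) * (a * ENNReal.ofReal (r ^ N * V)) := by
      refine (enorm_integral_le_lintegral_enorm _).trans ?_
      rw [ha_def, ← lintegral_indicator_eq_ballAvg hD hU,
        ← lintegral_const_mul' _ _ ENNReal.ofReal_ne_top]
      refine lintegral_mono fun z => ?_
      dsimp only
      by_cases h : η (t⁻¹ • (z - x)) = 0
      · simp [h]
      · have hz := mem_closedBall_of_kernel_ne_zero hηD ht0 h
        rw [indicator_of_mem (by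
          rw [Metric.mem_closedBall, dist_eq_norm]
          exact hz.trans (mul_le_mul_of_nonneg_left ht.2 hD.le)), ← ofReal_norm,
          ← ofReal_norm, ← ENNReal.ofReal_mul (by positivity)]
        refine ENNReal.ofReal_le_ofReal ?_
        rw [norm_mul]
        calc ‖inner ℝ (g z) (z - x)‖ * ‖η (t⁻¹ • (z - x))‖ ≤ (‖g z‖ * (D * t)) * Cη := by
              gcongr
              · exact (norm_inner_le_norm _ _).trans (by gcongr)
              · exact hCη _
          _ = D * t * Cη * ‖g z‖ := by ring
    rw [← ofReal_norm, ← ENNReal.ofReal_toReal ha,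
      ← ENNReal.ofReal_mul ENNReal.toReal_nonneg, ← ENNReal.ofReal_mul (by positivity),
      ENNReal.ofReal_le_ofReal_iff (by positivity)] at hJ
    rw [norm_mul, Real.norm_of_nonneg (by positivity : 0 ≤ (t ^ (N + 1))⁻¹)]
    calc (t ^ (N + 1))⁻¹ * _ ≤ (t ^ (N + 1))⁻¹ * (D * t * Cη * (a.toReal * (r ^ N * V))) := by
          gcongr
      _ = (t ^ N)⁻¹ * (D * Cη * a.toReal * (r ^ N * V)) := by
          rw [pow_succ]
          field_simp
      _ ≤ ((r / 2) ^ N)⁻¹ * (D * Cη * a.toReal * (r ^ N * V)) := by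
          have := ht.1
          gcongr
      _ = 2 ^ N * D * Cη * V * a.toReal := by
          rw [div_pow]
          field_simp
  have hmv := (convex_Icc (r / 2) r).norm_image_sub_le_of_norm_hasDerivWithin_le
    (f := kernelAvg U u η x) (fun t ht => (hasDerivAt_kernelAvg hug hη hc hηU
      (by linarith [ht.1]) (by linarith [ht.2])).hasDerivWithinAt) hderiv
    (x := r / 2) (y := r) ⟨le_rfl, by linarith⟩ ⟨by linarith, le_rfl⟩
  rw [edist_dist, dist_eq_norm, ← ENNReal.ofReal_toReal ha, ← ENNReal.ofReal_mul hr0.le,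
    ← ENNReal.ofReal_mul (by positivity)]
  refine ENNReal.ofReal_le_ofReal (hmv.trans ?_)
  rw [mul_comm r, ← mul_assoc]
  gcongr
  rw [Real.norm_of_nonneg (by linarith)]
  linarith

lemma tendsto_kernelAvg {U : Set (EuclideanSpace ℝ (Fin N))} (hU : MeasurableSet U)
    {u : EuclideanSpace ℝ (Fin N) → ℝ} (hu : LocallyIntegrable (U.indicator u))
    {η : EuclideanSpace ℝ (Fin N) → ℝ} (hη : Continuous η) (hc : HasCompactSupport η)
    (hη1 : ∫ w, η w = 1) {Cη D : ℝ} (hCη : ∀ w, ‖η w‖ ≤ Cη) (hD : 0 < D)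
    (hηD : tsupport η ⊆ Metric.closedBall 0 D) {x : EuclideanSpace ℝ (Fin N)} (hx : x ∈ U)
    (hLeb : Tendsto (fun k : ℕ => ⨍ y in Metric.closedBall x (D * 2⁻¹ ^ k),
      ‖U.indicator u y - U.indicator u x‖) atTop (𝓝 0)) :
    Tendsto (fun k : ℕ => kernelAvg U u η x (2⁻¹ ^ k)) atTop (𝓝 (u x)) := by
  set V := volume.real (Metric.closedBall (0 : EuclideanSpace ℝ (Fin N)) D)
  have hV : 0 < V := ENNReal.toReal_pos (Metric.measure_closedBall_pos _ _ hD).ne'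
    measure_closedBall_lt_top.ne
  have hC0 : 0 ≤ Cη := (norm_nonneg _).trans (hCη 0)
  rw [tendsto_iff_norm_sub_tendsto_zero]
  refine squeeze_zero (fun k => norm_nonneg _) (fun k => ?_)
    (by have h := hLeb.const_mul (Cη * V); rwa [mul_zero] at h)
  set r : ℝ := 2⁻¹ ^ k with hr
  have hr0 : 0 < r := by positivity
  set B := Metric.closedBall x (D * r)
  set w : EuclideanSpace ℝ (Fin N) → ℝ := fun z => (r ^ N)⁻¹ * η (r⁻¹ • (z - x)) with hw
  have hw0 : ∀ z, η (r⁻¹ • (z - x)) = 0 → w z = 0 := fun z h => by simp [hw, h]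
  have hwc : HasCompactSupport w := hasCompactSupport_kernel hc hr0 hw0
  have hwcont : Continuous w := continuous_const.mul (hη.comp (by fun_prop))
  have hwB : ∀ z, z ∉ B → w z = 0 := by
    intro z hz
    by_contra h
    refine hz ?_
    rw [Metric.mem_closedBall, dist_eq_norm]
    exact mem_closedBall_of_kernel_ne_zero hηD hr0 fun h' => h (hw0 z h')
  have hwle : ∀ z, ‖w z‖ ≤ (r ^ N)⁻¹ * Cη := by
    intro z
    rw [hw, norm_mul, Real.norm_of_nonneg (by positivity : 0 ≤ (r ^ N)⁻¹)]
    gcongr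
    exact hCη _
  have hw1 : ∫ z, w z = 1 := by
    rw [hw, integral_const_mul, integral_sub_right_eq_self (fun z => η (r⁻¹ • z)) x,
      Measure.integral_comp_inv_smul, hη1, finrank_euclideanSpace, Fintype.card_fin, abs_of_pos
      (by positivity), smul_eq_mul, mul_one, inv_mul_cancel₀ (by positivity)]
  have hA : kernelAvg U u η x r = ∫ z, U.indicator u z * w z := by
    rw [kernelAvg, ← integral_indicator hU]
    refine integral_congr_ae (ae_of_all _ fun z => ?_)
    by_cases hz : z ∈ U <;> simp [hz, hw]
  have hi1 : Integrable fun z => U.indicator u z * w z :=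
    integrable_mul_of_tsupport_subset (locallyIntegrableOn_univ.2 hu) hwcont hwc
      (subset_univ _)
  have hi2 : Integrable fun z => U.indicator u x * w z :=
    (hwcont.integrable_of_hasCompactSupport hwc).const_mul _
  have hux : u x = ∫ z, U.indicator u x * w z := by
    rw [integral_const_mul, hw1, mul_one, indicator_of_mem hx]
  have hloc : IntegrableOn (fun z => ‖U.indicator u z - U.indicator u x‖) B := by
    have h1 : IntegrableOn (U.indicator u) B :=
      hu.integrableOn_isCompact (isCompact_closedBall _ _)
    exact (Integrable.sub h1 (integrableOn_const measure_closedBall_lt_top.ne)).norm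
  have hvol : volume.real B = r ^ N * V := by
    rw [measureReal_def, Measure.addHaar_closedBall_center, volume_dyadicBall_eq hD,
      ENNReal.toReal_ofReal (by positivity)]
  calc ‖kernelAvg U u η x r - u x‖
      = ‖∫ z in B, (U.indicator u z - U.indicator u x) * w z‖ := by
        rw [hA, hux, ← integral_sub hi1 hi2, setIntegral_eq_integral_of_forall_compl_eq_zero]
        · simp only [sub_mul]
        · intro z hz
          rw [hwB z hz, mul_zero]
    _ ≤ ∫ z in B, ‖U.indicator u z - U.indicator u x‖ * ((r ^ N)⁻¹ * Cη) := by
        refine norm_integral_le_of_norm_le (hloc.mul_const _) (ae_of_all _ fun z => ?_)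
        rw [norm_mul]
        gcongr
        exact hwle z
    _ = _ := by
        rw [integral_mul_const, setAverage_eq, hvol, smul_eq_mul]
        field_simp

/-- A potential estimate for an arbitrary kernel `η` whose rescalings at `x` stay inside `U`. -/
lemma enorm_le_of_kernel {U : Set (EuclideanSpace ℝ (Fin N))} (hU : MeasurableSet U)
    {u : EuclideanSpace ℝ (Fin N) → ℝ}
    {g : EuclideanSpace ℝ (Fin N) → EuclideanSpace ℝ (Fin N)} (hug : IsWeakGradient U u g)
    (hu : LocallyIntegrable (U.indicator u))
    {η : EuclideanSpace ℝ (Fin N) → ℝ} (hη : ContDiff ℝ (⊤ : ℕ∞) η) (hc : HasCompactSupport η)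
    (hη1 : ∫ w, η w = 1) {Cη D : ℝ} (hCη0 : 0 < Cη) (hCη : ∀ w, ‖η w‖ ≤ Cη) (hD : 0 < D)
    (hηD : tsupport η ⊆ Metric.closedBall 0 D) {x : EuclideanSpace ℝ (Fin N)} (hx : x ∈ U)
    (hηU : ∀ t : ℝ, 0 < t → t < 2 → ∀ y ∈ tsupport η, x + t • y ∈ U)
    (hLeb : Tendsto (fun k : ℕ => ⨍ y in Metric.closedBall x (D * 2⁻¹ ^ k),
      ‖U.indicator u y - U.indicator u x‖) atTop (𝓝 0)) (j : ℕ) :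
    ‖u x‖ₑ ≤
      ENNReal.ofReal (Cη * volume.real (Metric.closedBall (0 : EuclideanSpace ℝ (Fin N)) D)) *
        ballAvg D (U.indicator fun z => ‖u z‖ₑ) j x +
      ENNReal.ofReal (2 ^ N * D * Cη *
        volume.real (Metric.closedBall (0 : EuclideanSpace ℝ (Fin N)) D)) *
        ∑' k, 2⁻¹ ^ (j + k) * ballAvg D (U.indicator fun z => ‖g z‖ₑ) (j + k) x := by
  have h1 := edist_le_tsum_of_edist_le_of_tendsto _
    (edist_kernelAvg_le hU hug hη hc hCη0 hCη hD hηD hηU)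
    (tendsto_kernelAvg hU hu hη.continuous hc hη1 hCη hD hηD hx hLeb) j
  rw [ENNReal.tsum_mul_left] at h1
  refine le_trans ?_ (add_le_add (enorm_kernelAvg_le hU u hCη hD hηD x j) h1)
  rw [edist_comm, edist_eq_enorm_sub]
  calc ‖u x‖ₑ = ‖kernelAvg U u η x (2⁻¹ ^ j) + (u x - kernelAvg U u η x (2⁻¹ ^ j))‖ₑ := by
        rw [add_sub_cancel]
    _ ≤ _ := enorm_add_le _ _

lemma smul_add_mem_finiteCone {x ξ : EuclideanSpace ℝ (Fin N)} {h c : ℝ} (hh : 0 < h)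
    (hc0 : 0 < c) (hc1 : c < 1) (hξ : ‖ξ‖ = 1) {t : ℝ} (ht0 : 0 < t) (ht2 : t < 2)
    {y : EuclideanSpace ℝ (Fin N)} (hy : y ∈ Metric.closedBall ((h / 4) • ξ) (h * (1 - c) / 8)) :
    x + t • y ∈ finiteCone x ξ h c := by
  rw [Metric.mem_closedBall, dist_eq_norm] at hy
  have hzn : ‖(h / 4) • ξ‖ = h / 4 := by
    rw [norm_smul, hξ, mul_one, Real.norm_of_nonneg (by positivity)]
  have hyn : ‖y‖ ≤ h / 4 + h * (1 - c) / 8 := by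
    have := norm_add_le ((h / 4) • ξ) (y - (h / 4) • ξ)
    rw [add_sub_cancel] at this
    linarith
  have hin : h / 4 - h * (1 - c) / 8 ≤ inner ℝ y ξ := by
    have h1 : inner ℝ y ξ = h / 4 + inner ℝ (y - (h / 4) • ξ) ξ := by
      rw [inner_sub_left, real_inner_smul_left, real_inner_self_eq_norm_sq, hξ]
      ring
    have h2 := neg_le_of_abs_le (abs_real_inner_le_norm (y - (h / 4) • ξ) ξ)
    rw [hξ, mul_one] at h2
    linarith
  have hhc : 0 < h * c := mul_pos hh hc0
  have hhc2 : 0 < h * c * (1 - c) := mul_pos hhc (by linarith)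
  have hs : x + t • y - x = t • y := by abel
  refine ⟨?_, ?_⟩
  · rw [hs, norm_smul, Real.norm_of_nonneg ht0.le]
    nlinarith [norm_nonneg y]
  · rw [hs, norm_smul, Real.norm_of_nonneg ht0.le, real_inner_smul_left, mul_left_comm]
    refine mul_le_mul_of_nonneg_left ?_ ht0.le
    refine (mul_le_mul_of_nonneg_left hyn hc0.le).trans (le_trans ?_ hin)
    nlinarith

/-- The potential estimate under a cone condition: at almost every vertex `x` of a cone of height
`h` and opening `arccos c` inside `U`, the value `u x` is bounded by an average of `|u|` at scale
`2 ^ (-j)` and a dyadic Riesz potential of the weak gradient, with a constant depending only on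
`N`, `h` and `c`. -/
lemma exists_potential_estimate {h c : ℝ} (hh : 0 < h) (hc0 : 0 < c) (hc1 : c < 1) :
    ∃ C : ℝ, 0 < C ∧ ∀ (U : Set (EuclideanSpace ℝ (Fin N))), MeasurableSet U →
      ∀ (u : EuclideanSpace ℝ (Fin N) → ℝ)
        (g : EuclideanSpace ℝ (Fin N) → EuclideanSpace ℝ (Fin N)),
      IsWeakGradient U u g → LocallyIntegrable (U.indicator u) →
      ∀ᵐ x, x ∈ U → (∃ ξ, ‖ξ‖ = 1 ∧ finiteCone x ξ h c ⊆ U) → ∀ j,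
        ‖u x‖ₑ ≤ ENNReal.ofReal C * (ballAvg h (U.indicator fun z => ‖u z‖ₑ) j x +
          ∑' k, 2⁻¹ ^ (j + k) * ballAvg h (U.indicator fun z => ‖g z‖ₑ) (j + k) x) := by
  set ρ := h * (1 - c) / 8 with hρ_def
  have hρ : 0 < ρ := by
    have : 0 < 1 - c := by linarith
    positivity
  set V := volume.real (Metric.closedBall (0 : EuclideanSpace ℝ (Fin N)) h)
  have hV : 0 < V := ENNReal.toReal_pos (Metric.measure_closedBall_pos _ _ hh).ne'
    measure_closedBall_lt_top.ne
  set Cη : ℝ := 1 / volume.real (Metric.closedBall (0 : EuclideanSpace ℝ (Fin N)) (ρ / 2))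
  have hCη : 0 < Cη := one_div_pos.2 (ENNReal.toReal_pos
    (Metric.measure_closedBall_pos _ _ (half_pos hρ)).ne' measure_closedBall_lt_top.ne)
  refine ⟨Cη * V + 2 ^ N * h * Cη * V, by positivity, fun U hU u g hug hu => ?_⟩
  filter_upwards [IsUnifLocDoublingMeasure.ae_tendsto_average_norm_sub volume hu 1] with x hLeb
  rintro hx ⟨ξ, hξ, hcone⟩ j
  let η : ContDiffBump ((h / 4) • ξ) := ⟨ρ / 2, ρ, half_pos hρ, half_lt_self hρ⟩
  have hsupp : tsupport (η.normed volume) = Metric.closedBall ((h / 4) • ξ) ρ :=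
    η.tsupport_normed_eq
  have hδ : Tendsto (fun k : ℕ => h * (2⁻¹ : ℝ) ^ k) atTop (𝓝[>] 0) := by
    refine tendsto_nhdsWithin_iff.2 ⟨?_, Eventually.of_forall fun k => dyadic_radius_pos hh k⟩
    simpa using (tendsto_pow_atTop_nhds_zero_of_lt_one (by norm_num : (0 : ℝ) ≤ 2⁻¹)
      (by norm_num)).const_mul h
  have hest := enorm_le_of_kernel hU hug hu (η := η.normed volume) (Cη := Cη) (D := h) (x := x)
    η.contDiff_normed η.hasCompactSupport_normed η.integral_normed hCη (fun w => ?_) hh ?_ hx ?_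
    (hLeb (fun _ => x) _ hδ (Eventually.of_forall fun k => by
      rw [one_mul]; exact Metric.mem_closedBall_self (dyadic_radius_pos hh k).le)) j
  · refine hest.trans ?_
    rw [mul_add]
    gcongr
    · exact le_add_of_nonneg_right (by positivity)
    · exact le_add_of_nonneg_left (by positivity)
  · rw [Real.norm_of_nonneg (η.nonneg_normed w)]
    refine (η.normed_le_div_measure_closedBall_rIn volume w).trans (le_of_eq ?_)
    simp only [Cη, measureReal_def]
    rw [Measure.addHaar_closedBall_center]
  · rw [hsupp]
    intro y hy
    rw [Metric.mem_closedBall, dist_eq_norm] at hy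
    rw [mem_closedBall_zero_iff]
    have := norm_add_le ((h / 4) • ξ) (y - (h / 4) • ξ)
    rw [add_sub_cancel, norm_smul, hξ, mul_one, Real.norm_of_nonneg (by positivity)] at this
    have : 0 < h * c := mul_pos hh hc0
    linarith
  · intro t ht0 ht2 y hy
    rw [hsupp] at hy
    exact hcone (smul_add_mem_finiteCone hh hc0 hc1 hξ ht0 ht2 hy)

end Potential

/-! ### Vanishing for functions controlled by a potential -/

section Vanishing

variable {N : ℕ}

/-- On `S`, the function `u` is bounded by `R f` and, at every dyadic scale `D 2 ^ (-j)`, by `C`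
times an average and the dyadic Riesz potential of `f`, where `∫ A(f) ≤ Λ`. This records all that
is needed of a Sobolev function: `f` stands for `(|∇u| + |u|) / R` on the ambient domain. -/
structure HasPotentialBound (A : ℝ → ℝ) (D C R Λ : ℝ) (S : Set (EuclideanSpace ℝ (Fin N)))
    (u f : EuclideanSpace ℝ (Fin N) → ℝ) : Prop where
  measurableSet : MeasurableSet S
  measurable : Measurable u
  measurable_density : Measurable f
  density_nonneg : ∀ x, 0 ≤ f x
  lintegral_le : ∫⁻ x, ENNReal.ofReal (A (f x)) ≤ ENNReal.ofReal Λ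
  abs_le : ∀ᵐ x, x ∈ S → |u x| ≤ R * f x
  enorm_le : ∀ᵐ x, x ∈ S → ∀ j, ‖u x‖ₑ ≤ ENNReal.ofReal C *
    (ballAvg D (fun y => ENNReal.ofReal (f y)) j x +
      ∑' k, 2⁻¹ ^ (j + k) * ballAvg D (fun y => ENNReal.ofReal (f y)) (j + k) x)

lemma tsum_ballAvg_le_dyadicMaximal (D : ℝ) (F : EuclideanSpace ℝ (Fin N) → ℝ≥0∞) (j : ℕ)
    (x : EuclideanSpace ℝ (Fin N)) :
    ∑' k, 2⁻¹ ^ (j + k) * ballAvg D F (j + k) x ≤ 2⁻¹ ^ j * 2 * dyadicMaximal D F x := by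
  calc ∑' k, 2⁻¹ ^ (j + k) * ballAvg D F (j + k) x
      ≤ ∑' k, 2⁻¹ ^ j * dyadicMaximal D F x * 2⁻¹ ^ k := by
        refine ENNReal.tsum_le_tsum fun k => ?_
        rw [pow_add, mul_right_comm]
        gcongr
        exact ballAvg_le_dyadicMaximal D F _ x
    _ = _ := by
        rw [ENNReal.tsum_mul_left, ENNReal.tsum_geometric, ENNReal.one_sub_inv_two, inv_inv,
          mul_right_comm]

/-- If `E` is a set of points around which the integral of `F` over balls of radius `r` is at
least `c`, then `E` has small measure as soon as it has small measure in every such ball. -/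
lemma mul_volume_le_of_le_setLIntegral {E : Set (EuclideanSpace ℝ (Fin N))}
    (hE : MeasurableSet E) {F : EuclideanSpace ℝ (Fin N) → ℝ≥0∞} (hF : Measurable F) {r : ℝ}
    {c s : ℝ≥0∞} (hc : ∀ x ∈ E, c ≤ ∫⁻ y in Metric.closedBall x r, F y)
    (hs : ∀ y, volume (E ∩ Metric.closedBall y r) ≤ s) :
    c * volume E ≤ (∫⁻ y, F y) * s := by
  have hT : MeasurableSet {p : EuclideanSpace ℝ (Fin N) × EuclideanSpace ℝ (Fin N) |
      dist p.2 p.1 ≤ r} := measurableSet_le (by fun_prop) measurable_const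
  set k : EuclideanSpace ℝ (Fin N) → EuclideanSpace ℝ (Fin N) → ℝ≥0∞ := fun x y =>
    {p : EuclideanSpace ℝ (Fin N) × EuclideanSpace ℝ (Fin N) | dist p.2 p.1 ≤ r}.indicator
      (fun p => F p.2) (x, y)
  have hk : Measurable (Function.uncurry k) := (hF.comp measurable_snd).indicator hT
  calc c * volume E = ∫⁻ _ in E, c := by rw [setLIntegral_const]
    _ ≤ ∫⁻ x in E, ∫⁻ y, k x y := by
        refine setLIntegral_mono_ae' hE (ae_of_all _ fun x hx => (hc x hx).trans ?_)
        rw [← lintegral_indicator Metric.isClosed_closedBall.measurableSet]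
        exact le_rfl
    _ = ∫⁻ y, ∫⁻ x in E, k x y := lintegral_lintegral_swap hk.aemeasurable
    _ ≤ ∫⁻ y, F y * s := by
        refine lintegral_mono fun y => ?_
        have h : ∀ x, k x y = (Metric.closedBall y r).indicator (fun _ => F y) x := by
          intro x
          simp only [k, indicator, Metric.mem_closedBall, mem_ofPred_eq, dist_comm x y]
        simp only [h]
        rw [setLIntegral_indicator Metric.isClosed_closedBall.measurableSet, setLIntegral_const,
          inter_comm]
        gcongr
        exact hs y
    _ = _ := lintegral_mul_const _ hF

variable {A : ℝ → ℝ} {l m : ℝ}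

/-- A superlevel set of a function with a potential bound has small measure if the modular of the
function over balls of a fixed radius is small. Where `|u| ≥ a`, either the maximal function is
large, which is rare, or the average over a small ball is bounded below, and the latter points are
counted by `mul_volume_le_of_le_setLIntegral`. -/
lemma HasGrowthBetween.exists_volume_superlevel_le (hA : HasGrowthBetween A l m) (hl : 1 < l)
    {D C R Λ ρ a θ : ℝ} (hD : 0 < D) (hC : 0 < C) (hρ : 0 < ρ) (ha : 0 < a)
    (hθ : 0 < θ) : ∃ K : ℝ≥0∞, K ≠ ∞ ∧ ∀ (S : Set (EuclideanSpace ℝ (Fin N))) u f,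
      HasPotentialBound A D C R Λ S u f → volume (S ∩ {x | a ≤ |u x|}) ≤ ENNReal.ofReal θ +
        K * ⨆ y, ∫⁻ x in Metric.ball y ρ ∩ S, ENNReal.ofReal (A |u x|) := by
  set CM := ENNReal.ofReal (5 ^ Module.finrank ℝ (EuclideanSpace ℝ (Fin N))) *
    ENNReal.ofReal (4 ^ m / (l - 1)) * ENNReal.ofReal Λ with hCM
  have hCMtop : CM ≠ ∞ := by finiteness
  set b := a / (4 * C)
  have hb : 0 < b := by positivity
  have hAb := hA.pos b hb
  have hAa := hA.pos a ha
  obtain ⟨j, hj1, hj2⟩ : ∃ j : ℕ, CM.toReal / θ ≤ A (b * 2 ^ j) ∧ D * 2⁻¹ ^ j < ρ := by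
    have h1 : Tendsto (fun j : ℕ => A (b * 2 ^ j)) atTop atTop :=
      (hA.tendsto_atTop hl.le).comp
        ((tendsto_pow_atTop_atTop_of_one_lt one_lt_two).const_mul_atTop hb)
    have h2 : Tendsto (fun j : ℕ => D * (2⁻¹ : ℝ) ^ j) atTop (𝓝 0) := by
      simpa using (tendsto_pow_atTop_nhds_zero_of_lt_one (by norm_num : (0 : ℝ) ≤ 2⁻¹)
        (by norm_num)).const_mul D
    exact ((h1.eventually_ge_atTop _).and (h2.eventually_lt_const hρ)).exists
  set vj := volume (Metric.closedBall (0 : EuclideanSpace ℝ (Fin N)) (D * 2⁻¹ ^ j))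
  have hvj : vj ≠ 0 := (volume_dyadicBall_pos hD j).ne'
  have hvj' : vj ≠ ∞ := volume_dyadicBall_ne_top D j
  set c := ENNReal.ofReal (A b) * vj
  have hc : c ≠ 0 := mul_ne_zero (by simpa using hAb) hvj
  have hc' : c ≠ ∞ := by finiteness
  have hAa0 : ENNReal.ofReal (A a) ≠ 0 := by simpa using hAa
  refine ⟨c⁻¹ * (ENNReal.ofReal Λ * (ENNReal.ofReal (A a))⁻¹), ?_, fun S u f h => ?_⟩
  · exact ENNReal.mul_ne_top (ENNReal.inv_ne_top.2 hc)
      (ENNReal.mul_ne_top ENNReal.ofReal_ne_top (ENNReal.inv_ne_top.2 hAa0))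
  set F : EuclideanSpace ℝ (Fin N) → ℝ≥0∞ := fun y => ENNReal.ofReal (f y)
  set s := ⨆ y, ∫⁻ x in Metric.ball y ρ ∩ S, ENNReal.ofReal (A |u x|)
  have hF : Measurable F := h.measurable_density.ennreal_ofReal
  have hAf : Measurable fun y => ENNReal.ofReal (A (f y)) :=
    (hA.measurable_comp h.measurable_density h.density_nonneg).ennreal_ofReal
  obtain ⟨H, hH, hHM, hHint⟩ := hA.exists_maximal_modular hl hD h.measurable_density
    h.density_nonneg
  have hHint' : ∫⁻ x, H x ≤ CM := hHint.trans (by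
    rw [hCM]
    exact mul_le_mul_right h.lintegral_le _)
  set E := S ∩ {x | a ≤ |u x|}
  have hE : MeasurableSet E := h.measurableSet.inter
    (measurableSet_le measurable_const (by simpa using h.measurable.norm))
  set E₁ := E ∩ {x | ENNReal.ofReal (2 * b) ≤ ballAvg D F j x}
  have hE₁ : MeasurableSet E₁ :=
    hE.inter (measurableSet_le measurable_const (measurable_ballAvg hF D j))
  set E₂ := {x | ENNReal.ofReal (A (b * 2 ^ j)) ≤ H x}
  have hcover : E ≤ᵐ[volume] (E₁ ∪ E₂ : Set _) := by
    filter_upwards [h.enorm_le] with x hx hxE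
    by_contra hcon
    have h1 : ballAvg D F j x < ENNReal.ofReal (2 * b) :=
      not_le.1 fun h1 => hcon (Or.inl ⟨hxE, h1⟩)
    have h2 : dyadicMaximal D F x < ENNReal.ofReal (b * 2 ^ j) :=
      not_le.1 fun h2 => hcon (Or.inr (hHM x _ (by positivity) h2))
    have hx' := hx hxE.1 j
    have h3 : 2⁻¹ ^ j * 2 * dyadicMaximal D F x ≤ ENNReal.ofReal (2 * b) := by
      refine (mul_le_mul_right h2.le _).trans (le_of_eq ?_)
      rw [← ENNReal.ofReal_ofNat, ← ENNReal.ofReal_inv_of_pos (by norm_num),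
        ← ENNReal.ofReal_pow (by norm_num), ← ENNReal.ofReal_mul (by positivity),
        ← ENNReal.ofReal_mul (by positivity)]
      congr 1
      rw [inv_pow]
      field_simp
    have h4 : ‖u x‖ₑ < ENNReal.ofReal C * (ENNReal.ofReal (2 * b) + ENNReal.ofReal (2 * b)) := by
      refine hx'.trans_lt ?_
      rw [ENNReal.mul_lt_mul_iff_right (by simpa using hC) ENNReal.ofReal_ne_top]
      exact ENNReal.add_lt_add_of_lt_of_le
        (((tsum_ballAvg_le_dyadicMaximal D F j x).trans h3).trans_lt ENNReal.ofReal_lt_top).ne h1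
        ((tsum_ballAvg_le_dyadicMaximal D F j x).trans h3)
    rw [← ENNReal.ofReal_add (by positivity) (by positivity), ← ENNReal.ofReal_mul hC.le,
      ← ofReal_norm, ENNReal.ofReal_lt_ofReal_iff (by positivity), Real.norm_eq_abs] at h4
    have h5 : C * (2 * b + 2 * b) = a := by simp only [b]; field_simp; ring
    rw [h5] at h4
    exact absurd hxE.2 (not_le.2 h4)
  have hvol₂ : volume E₂ ≤ ENNReal.ofReal θ := by
    have h1 := (mul_meas_ge_le_lintegral hH (ENNReal.ofReal (A (b * 2 ^ j)))).trans hHint'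
    have hp : 0 < A (b * 2 ^ j) := hA.pos _ (by positivity)
    have h2 : CM ≤ ENNReal.ofReal (A (b * 2 ^ j)) * ENNReal.ofReal θ := by
      rw [← ENNReal.ofReal_mul hp.le, ← ENNReal.ofReal_toReal hCMtop]
      exact ENNReal.ofReal_le_ofReal ((div_le_iff₀ hθ).1 hj1)
    exact (ENNReal.mul_le_mul_iff_right (by simpa using hp) ENNReal.ofReal_ne_top).1 (h1.trans h2)
  have hloc : ∀ y, volume (E₁ ∩ Metric.closedBall y (D * 2⁻¹ ^ j)) ≤
      (ENNReal.ofReal (A a))⁻¹ * s := by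
    intro y
    rw [← ENNReal.div_eq_inv_mul, ENNReal.le_div_iff_mul_le (Or.inl hAa0)
      (Or.inl ENNReal.ofReal_ne_top), mul_comm]
    have hBm : MeasurableSet (E₁ ∩ Metric.closedBall y (D * 2⁻¹ ^ j)) :=
      hE₁.inter Metric.isClosed_closedBall.measurableSet
    calc ENNReal.ofReal (A a) * volume (E₁ ∩ Metric.closedBall y (D * 2⁻¹ ^ j))
        = ∫⁻ _ in E₁ ∩ Metric.closedBall y (D * 2⁻¹ ^ j), ENNReal.ofReal (A a) := by
          rw [setLIntegral_const]
      _ ≤ ∫⁻ x in E₁ ∩ Metric.closedBall y (D * 2⁻¹ ^ j), ENNReal.ofReal (A |u x|) := by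
          refine setLIntegral_mono_ae' hBm (ae_of_all _ fun x hx => ENNReal.ofReal_le_ofReal ?_)
          have hax : a ≤ |u x| := hx.1.1.2
          exact (hA.strictMonoOn hl.le).monotoneOn ha.le (ha.le.trans hax) hax
      _ ≤ ∫⁻ x in Metric.ball y ρ ∩ S, ENNReal.ofReal (A |u x|) :=
          lintegral_mono_set fun x hx =>
            ⟨Metric.closedBall_subset_ball hj2 hx.2, hx.1.1.1⟩
      _ ≤ s := le_iSup (fun y => ∫⁻ x in Metric.ball y ρ ∩ S, ENNReal.ofReal (A |u x|)) y
  have hlow : ∀ x ∈ E₁, c ≤ ∫⁻ y in Metric.closedBall x (D * 2⁻¹ ^ j), ENNReal.ofReal (A (f y)) := by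
    intro x hx
    rw [setLIntegral_eq_ballAvg_mul hD]
    refine mul_le_mul_left ?_ _
    have h1 := hx.2.out.trans
      (hA.ballAvg_le_add hl.le hD h.measurable_density h.density_nonneg hb j x)
    rw [two_mul, ENNReal.ofReal_add hb.le hb.le,
      ENNReal.add_le_add_iff_left ENNReal.ofReal_ne_top] at h1
    have h2 := mul_le_mul_right h1 (ENNReal.ofReal (A b / b))
    rw [← mul_assoc, ← ENNReal.ofReal_mul (by positivity), ← ENNReal.ofReal_mul (by positivity),
      div_mul_cancel₀ _ hb.ne', div_mul_div_cancel₀ hb.ne', div_self hAb.ne', ENNReal.ofReal_one,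
      one_mul] at h2
    exact h2
  have hvol₁ : volume E₁ ≤ c⁻¹ * (ENNReal.ofReal Λ * (ENNReal.ofReal (A a))⁻¹) * s := by
    have h1 := mul_volume_le_of_le_setLIntegral hE₁ hAf hlow hloc
    rw [mul_assoc, ← ENNReal.div_eq_inv_mul, ENNReal.le_div_iff_mul_le (Or.inl hc) (Or.inl hc'),
      mul_comm, mul_assoc (ENNReal.ofReal Λ)]
    exact h1.trans (mul_le_mul_left h.lintegral_le _)
  calc volume E ≤ volume (E₁ ∪ E₂) := measure_mono_ae hcover
    _ ≤ volume E₁ + volume E₂ := measure_union_le _ _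
    _ ≤ _ := by
        rw [add_comm]
        exact add_le_add hvol₂ hvol₁

lemma IsNFunction.nonneg {B : ℝ → ℝ} (hB : IsNFunction B) (t : ℝ) : 0 ≤ B t := by
  have h := hB.convex.2 (mem_univ t) (mem_univ (-t)) (by norm_num : (0 : ℝ) ≤ 1 / 2)
    (by norm_num : (0 : ℝ) ≤ 1 / 2) (by norm_num)
  have h0 : (1 / 2 : ℝ) • t + (1 / 2 : ℝ) • (-t) = 0 := by simp
  rw [h0, (hB.eq_zero_iff 0).2 rfl, hB.even] at h
  simp only [smul_eq_mul] at h
  linarith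

lemma apply_two_pow_mul_le {B : ℝ → ℝ} {K : ℝ} (hK : 0 < K)
    (hB : ∀ t ≥ 0, B (2 * t) ≤ K * B t) (J : ℕ) {t : ℝ} (ht : 0 ≤ t) :
    B (2 ^ J * t) ≤ K ^ J * B t := by
  induction J with
  | zero => simp
  | succ J ih =>
    calc B (2 ^ (J + 1) * t) = B (2 * (2 ^ J * t)) := by ring_nf
      _ ≤ K * B (2 ^ J * t) := hB _ (by positivity)
      _ ≤ K * (K ^ J * B t) := by gcongr
      _ = K ^ (J + 1) * B t := by ring

/-- A function growing more slowly than `A` at `0` and than `A_*` at infinity is dominated by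
`δ A`, `δ A_*` and a constant multiple of the indicator of a superlevel set. Where `As t = 0` the
hypothesis is void because `B t / 0 = 0`, so the bound by `As` is conditional on `0 < As t`. -/
lemma exists_growth_split {B : ℝ → ℝ} {As : ℝ → ℝ} (hB : IsNFunction B)
    (hA : HasGrowthBetween A l m)
    (hB0 : Tendsto (fun t => B t / A t) (𝓝[≠] 0) (𝓝 0))
    (hBinf : Tendsto (fun t => B t / As t) (Bornology.cobounded ℝ) (𝓝 0)) {δ : ℝ} (hδ : 0 < δ) :
    ∃ a b : ℝ, 0 < a ∧ 0 ≤ b ∧ ∀ t, 0 < t →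
      (t < a → B t ≤ δ * A t) ∧ (a ≤ t → B t ≤ b ∨ (0 < As t → B t ≤ δ * As t)) := by
  obtain ⟨a, ha, ha'⟩ : ∃ a > 0, ∀ t, 0 < t → t < a → B t / A t < δ := by
    have h := hB0.eventually_lt_const hδ
    rw [eventually_nhdsWithin_iff, Metric.eventually_nhds_iff] at h
    obtain ⟨a, ha, h⟩ := h
    refine ⟨a, ha, fun t ht hta => h ?_ ht.ne'⟩
    rw [Real.dist_eq, sub_zero, abs_of_pos ht]
    exact hta
  obtain ⟨T, hT⟩ : ∃ T, ∀ t, T < t → B t / As t < δ := by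
    have h := hBinf.eventually_lt_const hδ
    rw [← comap_norm_atTop, eventually_comap] at h
    obtain ⟨T, hT⟩ := eventually_atTop.1 h
    exact ⟨T, fun t ht => hT ‖t‖ (ht.le.trans (le_abs_self t)) t rfl⟩
  obtain ⟨b, hb⟩ := (isCompact_Icc (a := a) (b := T)).bddAbove_image hB.continuous.continuousOn
  refine ⟨a, max b 0, ha, le_max_right _ _, fun t ht => ⟨fun hta => ?_, fun hat => ?_⟩⟩
  · exact ((div_lt_iff₀ (hA.pos t ht)).1 (ha' t ht hta)).le
  · rcases le_or_gt t T with h | h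
    · exact Or.inl ((hb (mem_image_of_mem B ⟨hat, h⟩)).trans (le_max_left _ _))
    · exact Or.inr fun hp => ((div_lt_iff₀ hp).1 (hT t h)).le

/-- The Orlicz–Sobolev embedding in pointwise form: up to a fixed dilation, `A_*(|u|)` is bounded
by the function representing `A(M f)`. -/
lemma HasGrowthBetween.exists_sobolevConj_le (hA : HasGrowthBetween A l m) (hl : 1 < l)
    (hm : 0 < m) (hN : 0 < N) (hmN : m < N) {D C R Λ : ℝ} (hD : 0 < D) (hC : 0 < C)
    (hΛ : 0 < Λ) : ∃ lam : ℝ, 0 < lam ∧ ∀ (S : Set (EuclideanSpace ℝ (Fin N))) u f,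
      HasPotentialBound A D C R Λ S u f → ∃ H : EuclideanSpace ℝ (Fin N) → ℝ≥0∞, Measurable H ∧
        ∫⁻ x, H x ≤ ENNReal.ofReal (5 ^ N * (4 ^ m / (l - 1)) * Λ) ∧
        ∀ᵐ x, x ∈ S → ∀ w, 0 < w → w ≤ |u x| / lam →
          0 < sobolevConj N A w ∧ ENNReal.ofReal (sobolevConj N A w) ≤ H x := by
  have hl1 : 0 < l - 1 := by linarith
  obtain ⟨C', hC', hsum⟩ := hA.tsum_ballAvg_le (E := EuclideanSpace ℝ (Fin N)) hl.le hm
    (by simpa using hN) (by simpa using hmN) hD hΛ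
  refine ⟨2 * C * C', by positivity, fun S u f h => ?_⟩
  set F : EuclideanSpace ℝ (Fin N) → ℝ≥0∞ := fun y => ENNReal.ofReal (f y)
  obtain ⟨H, hH, hHM, hHint⟩ := hA.exists_maximal_modular hl hD h.measurable_density
    h.density_nonneg
  have hHle : ∫⁻ x, H x ≤ ENNReal.ofReal (5 ^ N * (4 ^ m / (l - 1)) * Λ) := by
    refine hHint.trans ?_
    rw [ENNReal.ofReal_mul (by positivity), ENNReal.ofReal_mul (by positivity),
      finrank_euclideanSpace_fin]
    exact mul_le_mul_right h.lintegral_le _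
  refine ⟨H, hH, hHle, ?_⟩
  filter_upwards [h.enorm_le, ae_lt_top hH (hHle.trans_lt ENNReal.ofReal_lt_top).ne]
    with x hx hHx hxS w hw hwu
  have hMx : dyadicMaximal D F x ≠ ∞ := by
    intro htop
    obtain ⟨t, ht0, ht⟩ := ((eventually_ge_atTop (0 : ℝ)).and
      ((hA.tendsto_atTop hl.le).eventually_gt_atTop (H x).toReal)).exists
    have h1 := hHM x t ht0 (by rw [htop]; exact le_top)
    rw [← ENNReal.ofReal_toReal hHx.ne, ENNReal.ofReal_le_ofReal_iff ENNReal.toReal_nonneg] at h1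
    linarith
  set μ := (dyadicMaximal D F x).toReal
  have hμ : 0 ≤ μ := ENNReal.toReal_nonneg
  have hMμ : dyadicMaximal D F x = ENNReal.ofReal μ := (ENNReal.ofReal_toReal hMx).symm
  have hs := hsum f h.measurable_density h.density_nonneg h.lintegral_le x μ hμ hMμ.le
  rw [finrank_euclideanSpace_fin] at hs
  have hG0 : 0 ≤ sobolevG N A (A μ) := by
    have := (hA.sobolevG_strictMonoOn hl.le hm hN hmN).monotoneOn self_mem_Ici (hA.nonneg hμ)
      (hA.nonneg hμ)
    rwa [sobolevG_zero] at this
  have hu : |u x| ≤ 2 * C * C' * sobolevG N A (A μ) := by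
    have h1 := hx hxS 0
    simp only [zero_add] at h1
    have h2 : ballAvg D F 0 x ≤ ∑' k, 2⁻¹ ^ k * ballAvg D F k x := by
      have := ENNReal.le_tsum (f := fun k => 2⁻¹ ^ k * ballAvg D F k x) 0
      simpa using this
    have h3 := h1.trans (mul_le_mul_right (add_le_add (h2.trans hs) hs) _)
    rw [← ENNReal.ofReal_add (by positivity) (by positivity), ← ENNReal.ofReal_mul hC.le,
      ← ofReal_norm, ENNReal.ofReal_le_ofReal_iff (by positivity), Real.norm_eq_abs] at h3
    linarith
  have hwG : w ≤ sobolevG N A (A μ) := hwu.trans ((div_le_iff₀ (by positivity)).2 (by linarith))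
  obtain ⟨hp, hle⟩ := hA.sobolevConj_le hl.le hm hN hmN (hA.nonneg hμ) hw hwG
  exact ⟨hp, (ENNReal.ofReal_le_ofReal hle).trans (hHM x μ hμ hMμ.ge)⟩

/-- Vanishing of the local modulars forces `∫ B(|u n|) → 0` for a sequence with uniform potential
bounds. -/
lemma HasGrowthBetween.tendsto_lintegral_zero (hA : HasGrowthBetween A l m) (hl : 1 < l)
    (hm : 0 < m) (hN : 0 < N) (hmN : m < N) {D C R Λ ρ : ℝ} (hD : 0 < D) (hC : 0 < C)
    (hΛ : 0 < Λ) (hρ : 0 < ρ) {S : ℕ → Set (EuclideanSpace ℝ (Fin N))}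
    {u : ℕ → EuclideanSpace ℝ (Fin N) → ℝ}
    (hu : ∀ᶠ n in atTop, ∃ f, HasPotentialBound A D C R Λ (S n) (u n) f)
    (hvanish : Tendsto (fun n => ⨆ y, ∫⁻ x in Metric.ball y ρ ∩ S n, ENNReal.ofReal (A |u n x|))
      atTop (𝓝 0)) {B : ℝ → ℝ} (hB : IsNFunction B) (hBΔ : SatisfiesDelta2 B)
    (hB0 : Tendsto (fun t => B t / A t) (𝓝[≠] 0) (𝓝 0))
    (hBinf : Tendsto (fun t => B t / sobolevConj N A t) (Bornology.cobounded ℝ) (𝓝 0)) :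
    Tendsto (fun n => ∫⁻ x in S n, ENNReal.ofReal (B |u n x|)) atTop (𝓝 0) := by
  have hl1 : 0 < l - 1 := by linarith
  obtain ⟨K, hK, hBK⟩ := hBΔ
  obtain ⟨lam, hlam, hconj⟩ :=
    hA.exists_sobolevConj_le hl hm hN hmN (R := R) hD hC hΛ
  -- A dyadic dilation that serves both the Sobolev estimate and the comparison `|u| ≤ R f`.
  obtain ⟨J, hJ⟩ := pow_unbounded_of_one_lt (max R lam) (one_lt_two : (1 : ℝ) < 2)
  have hJR : R ≤ 2 ^ J := (le_max_left _ _).trans hJ.le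
  have hJl : lam ≤ 2 ^ J := (le_max_right _ _).trans hJ.le
  set L := 5 ^ N * (4 ^ m / (l - 1)) * Λ
  have hL : 0 < L := by positivity
  rw [ENNReal.tendsto_nhds_zero]
  intro e' he'
  obtain ⟨e, he, hee'⟩ : ∃ e : ℝ, 0 < e ∧ ENNReal.ofReal e ≤ e' := by
    obtain ⟨e, _, he1, he2⟩ := ENNReal.lt_iff_exists_real_btwn.1 he'
    exact ⟨e, by simpa using he1, he2.le⟩
  set δ := e / (3 * K ^ J * (Λ + L)) with hδ_def
  have hδ : 0 < δ := by positivity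
  obtain ⟨a, b, ha, hb, hsplit⟩ := exists_growth_split hB hA hB0 hBinf hδ
  set θ := e / (3 * K ^ J * (b + 1)) with hθ_def
  have hθ : 0 < θ := by positivity
  obtain ⟨K', hK', hlevel⟩ := hA.exists_volume_superlevel_le (N := N) (R := R) (Λ := Λ) hl hD hC hρ
    (by positivity : 0 < 2 ^ J * a) hθ
  have hsmall : ∀ᶠ n in atTop, K' *
      (⨆ y, ∫⁻ x in Metric.ball y ρ ∩ S n, ENNReal.ofReal (A |u n x|)) ≤ ENNReal.ofReal θ := by
    have h := ENNReal.Tendsto.const_mul hvanish (Or.inr hK')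
    rw [mul_zero] at h
    exact (ENNReal.tendsto_nhds_zero.1 h) _ (by simpa using hθ)
  filter_upwards [hu, hsmall] with n hn hsn
  obtain ⟨f, hf⟩ := hn
  obtain ⟨H, hH, hHint, hHle⟩ := hconj _ _ _ hf
  have hvol : volume (S n ∩ {x | 2 ^ J * a ≤ |u n x|}) ≤ ENNReal.ofReal (2 * θ) := by
    refine (hlevel _ _ _ hf).trans ?_
    rw [two_mul, ENNReal.ofReal_add hθ.le hθ.le]
    gcongr
  have hAf : Measurable fun y => ENNReal.ofReal (A (f y)) :=
    (hA.measurable_comp hf.measurable_density hf.density_nonneg).ennreal_ofReal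
  have hAH : Measurable fun x => ENNReal.ofReal (A (f x)) + H x := hAf.add hH
  have hpoint : ∀ᵐ x, x ∈ S n → ENNReal.ofReal (B |u n x|) ≤ ENNReal.ofReal (K ^ J) *
      (ENNReal.ofReal δ * (ENNReal.ofReal (A (f x)) + H x) +
        (S n ∩ {x | 2 ^ J * a ≤ |u n x|}).indicator (fun _ => ENNReal.ofReal b) x) := by
    filter_upwards [hf.abs_le, hHle] with x hx1 hx2 hxS
    set w := |u n x| / 2 ^ J
    have hw0 : 0 ≤ w := by positivity
    have hwu : |u n x| = 2 ^ J * w := by simp only [w]; field_simp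
    have hBw : B |u n x| ≤ K ^ J * B w := by
      rw [hwu]
      exact apply_two_pow_mul_le hK hBK J hw0
    refine (ENNReal.ofReal_le_ofReal hBw).trans ?_
    rw [ENNReal.ofReal_mul (by positivity)]
    refine mul_le_mul_right ?_ _
    rcases eq_or_lt_of_le hw0 with h0 | h0
    · rw [← h0, (hB.eq_zero_iff 0).2 rfl]
      simp
    rcases lt_or_ge w a with hwa | hwa
    · have h1 : w ≤ f x := by
        simp only [w]
        rw [div_le_iff₀ (by positivity), mul_comm]
        exact (hx1 hxS).trans (mul_le_mul_of_nonneg_right hJR (hf.density_nonneg x))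
      have h2 : B w ≤ δ * A (f x) := ((hsplit w h0).1 hwa).trans (mul_le_mul_of_nonneg_left
        ((hA.strictMonoOn hl.le).monotoneOn hw0 (hw0.trans h1) h1) hδ.le)
      refine (ENNReal.ofReal_le_ofReal h2).trans ?_
      rw [ENNReal.ofReal_mul hδ.le, mul_add, add_assoc]
      exact le_self_add
    · rcases (hsplit w h0).2 hwa with h1 | h1
      · have hmem : x ∈ S n ∩ {x | 2 ^ J * a ≤ |u n x|} :=
          ⟨hxS, by rw [mem_ofPred_eq, hwu]; gcongr⟩
        rw [indicator_of_mem hmem]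
        exact (ENNReal.ofReal_le_ofReal h1).trans le_add_self
      · obtain ⟨hp, hle⟩ := hx2 hxS w h0 (by simp only [w]; gcongr)
        refine (ENNReal.ofReal_le_ofReal (h1 hp)).trans ?_
        rw [ENNReal.ofReal_mul hδ.le]
        calc ENNReal.ofReal δ * ENNReal.ofReal (sobolevConj N A w)
            ≤ ENNReal.ofReal δ * H x := by gcongr
          _ ≤ ENNReal.ofReal δ * (ENNReal.ofReal (A (f x)) + H x) := by
              gcongr
              exact le_add_self
          _ ≤ _ := le_self_add
  refine le_trans ?_ hee'
  calc ∫⁻ x in S n, ENNReal.ofReal (B |u n x|)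
      ≤ ∫⁻ x in S n, ENNReal.ofReal (K ^ J) *
        (ENNReal.ofReal δ * (ENNReal.ofReal (A (f x)) + H x) +
        (S n ∩ {x | 2 ^ J * a ≤ |u n x|}).indicator (fun _ => ENNReal.ofReal b) x) :=
        setLIntegral_mono_ae' hf.measurableSet hpoint
    _ ≤ ∫⁻ x, ENNReal.ofReal (K ^ J) *
        (ENNReal.ofReal δ * (ENNReal.ofReal (A (f x)) + H x) +
        (S n ∩ {x | 2 ^ J * a ≤ |u n x|}).indicator (fun _ => ENNReal.ofReal b) x) :=
        setLIntegral_le_lintegral _ _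
    _ ≤ ENNReal.ofReal (K ^ J) * (ENNReal.ofReal δ * (ENNReal.ofReal Λ + ENNReal.ofReal L) +
          ENNReal.ofReal b * ENNReal.ofReal (2 * θ)) := by
        rw [lintegral_const_mul' _ _ ENNReal.ofReal_ne_top,
          lintegral_add_left (hAH.const_mul _), lintegral_const_mul _ hAH,
          lintegral_add_left hAf]
        gcongr
        · exact hf.lintegral_le
        · exact (lintegral_indicator_const_le _ _).trans (by gcongr)
    _ ≤ ENNReal.ofReal e := by
        rw [← ENNReal.ofReal_add hΛ.le hL.le, ← ENNReal.ofReal_mul hδ.le,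
          ← ENNReal.ofReal_mul hb, ← ENNReal.ofReal_add (by positivity) (by positivity),
          ← ENNReal.ofReal_mul (by positivity)]
        refine ENNReal.ofReal_le_ofReal ?_
        have h1 : K ^ J * (δ * (Λ + L)) = e / 3 := by rw [hδ_def]; field_simp
        have h2 : K ^ J * ((b + 1) * (2 * θ)) = 2 * e / 3 := by rw [hθ_def]; field_simp
        have h3 : K ^ J * (b * (2 * θ)) ≤ K ^ J * ((b + 1) * (2 * θ)) := by
          gcongr
          linarith
        rw [mul_add]
        linarith

end Vanishing

/-! ### Orlicz–Sobolev functions have potential bounds -/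

section OrliczSobolev

variable {N : ℕ} {A : ℝ → ℝ} {l m : ℝ}

lemma HasGrowthBetween.lintegral_le_one_of_luxemburgNorm_le (hA : HasGrowthBetween A l m)
    (hl : 1 ≤ l) {F : Type*} [NormedAddCommGroup F] {w : EuclideanSpace ℝ (Fin N) → ℝ}
    (hw : ∀ x, 0 ≤ w x) {U : Set (EuclideanSpace ℝ (Fin N))} {f : EuclideanSpace ℝ (Fin N) → F}
    {C₀ R : ℝ} (hR : C₀ < R) (hR0 : 0 < R)
    (h : luxemburgNorm A w U f ≤ ENNReal.ofReal C₀) :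
    ∫⁻ x in U, ENNReal.ofReal (w x * A (‖f x‖ / R)) ≤ 1 := by
  obtain ⟨_, ⟨r, hr, rfl, hint⟩, hlt⟩ :=
    sInf_lt_iff.1 (h.trans_lt ((ENNReal.ofReal_lt_ofReal_iff hR0).2 hR))
  have hrR : r ≤ R := ((ENNReal.ofReal_lt_ofReal_iff hR0).1 hlt).le
  refine (lintegral_mono fun x => ENNReal.ofReal_le_ofReal ?_).trans hint
  refine mul_le_mul_of_nonneg_left ?_ (hw x)
  exact (hA.strictMonoOn hl).monotoneOn (show (0 : ℝ) ≤ _ by positivity)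
    (show (0 : ℝ) ≤ _ by positivity) (by gcongr)

lemma HasGrowthBetween.locallyIntegrable_indicator (hA : HasGrowthBetween A l m) (hl : 1 ≤ l)
    {U : Set (EuclideanSpace ℝ (Fin N))} (hU : MeasurableSet U)
    {u : EuclideanSpace ℝ (Fin N) → ℝ} (hu : AEStronglyMeasurable u (volume.restrict U))
    {R : ℝ} (hR : 0 < R) (hint : ∫⁻ x in U, ENNReal.ofReal (A (‖u x‖ / R)) ≠ ∞) :
    LocallyIntegrable (U.indicator u) := by
  rw [locallyIntegrable_iff]
  intro K hK
  refine ⟨((aestronglyMeasurable_indicator_iff hU).2 hu).restrict, ?_⟩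
  have hA1 := hA.pos 1 one_pos
  have hKtop : volume K ≠ ∞ := hK.measure_lt_top.ne
  calc ∫⁻ x in K, ‖U.indicator u x‖ₑ
      ≤ ∫⁻ x in K, (ENNReal.ofReal R + ENNReal.ofReal (R / A 1) *
          U.indicator (fun x => ENNReal.ofReal (A (‖u x‖ / R))) x) := by
        refine lintegral_mono fun x => ?_
        dsimp only
        by_cases hx : x ∈ U
        · rw [indicator_of_mem hx, indicator_of_mem hx, ← ofReal_norm,
            ← ENNReal.ofReal_mul (by positivity),
            ← ENNReal.ofReal_add hR.le (mul_nonneg (by positivity) (hA.nonneg (by positivity)))]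
          refine ENNReal.ofReal_le_ofReal ?_
          have h := mul_le_mul_of_nonneg_left
            (hA.le_add_mul hl one_pos (by positivity : 0 ≤ ‖u x‖ / R)) hR.le
          rw [mul_div_cancel₀ _ hR.ne'] at h
          refine h.trans (le_of_eq ?_)
          ring
        · simp [hx]
    _ = ENNReal.ofReal R * volume K + ENNReal.ofReal (R / A 1) *
          ∫⁻ x in K, U.indicator (fun x => ENNReal.ofReal (A (‖u x‖ / R))) x := by
        rw [lintegral_add_left measurable_const, setLIntegral_const,
          lintegral_const_mul' _ _ ENNReal.ofReal_ne_top]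
    _ < ∞ := by
        have h : ∫⁻ x in K, U.indicator (fun x => ENNReal.ofReal (A (‖u x‖ / R))) x ≠ ∞ := by
          refine ne_top_of_le_ne_top hint ((setLIntegral_le_lintegral _ _).trans ?_)
          rw [lintegral_indicator hU]
        finiteness

/-- A Sobolev function on `U` with normalised modulars has a potential bound on every set of
vertices of cones of fixed size in `U`. -/
lemma HasGrowthBetween.exists_hasPotentialBound (hA : HasGrowthBetween A l m) (hl : 1 ≤ l)
    {h c R Λ : ℝ} (hh : 0 < h) (hc0 : 0 < c) (hc1 : c < 1) (hR : 0 < R) (hΛ : 0 < Λ) :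
    ∃ C : ℝ, 0 < C ∧ ∀ (U S : Set (EuclideanSpace ℝ (Fin N))), MeasurableSet U →
      MeasurableSet S → S ⊆ U → (∀ x ∈ S, ∃ ξ, ‖ξ‖ = 1 ∧ finiteCone x ξ h c ⊆ U) →
      ∀ (u : EuclideanSpace ℝ (Fin N) → ℝ)
        (g : EuclideanSpace ℝ (Fin N) → EuclideanSpace ℝ (Fin N)), IsWeakGradient U u g →
      ∫⁻ x in U, ENNReal.ofReal (A (‖g x‖ / R)) ≤ 1 →
      ∫⁻ x in U, ENNReal.ofReal (A (‖u x‖ / R)) ≤ ENNReal.ofReal Λ →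
      ∃ u' f, u =ᵐ[volume.restrict S] u' ∧
        HasPotentialBound A h C R (2 ^ m * (1 + Λ)) S u' f := by
  obtain ⟨C, hC, hpot⟩ := exists_potential_estimate (N := N) hh hc0 hc1
  refine ⟨C * R, by positivity, fun U S hU hS hSU hcone u g hug hgint huint => ?_⟩
  have hum : AEStronglyMeasurable u (volume.restrict U) :=
    hug.locallyIntegrable.aestronglyMeasurable
  have hgm : AEStronglyMeasurable g (volume.restrict U) :=
    hug.locallyIntegrable_grad.aestronglyMeasurable
  have hloc := hA.locallyIntegrable_indicator hl hU hum hR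
    (ne_top_of_le_ne_top ENNReal.ofReal_ne_top huint)
  -- The density is chosen measurable and nonnegative everywhere.
  set p : EuclideanSpace ℝ (Fin N) → ℝ := fun x => (‖g x‖ + ‖u x‖) / R with hp
  have hp0 : ∀ x, 0 ≤ p x := fun x => by positivity
  have hpm : AEMeasurable (U.indicator p) :=
    (aemeasurable_indicator_iff hU).2
      ((hgm.norm.aemeasurable.add hum.norm.aemeasurable).div_const R)
  set f : EuclideanSpace ℝ (Fin N) → ℝ := fun x => |hpm.mk _ x|
  have hfm : Measurable f := hpm.measurable_mk.abs
  have hfe : U.indicator p =ᵐ[volume] f := by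
    filter_upwards [hpm.ae_eq_mk] with x hx
    simp only [f]
    rw [← hx, abs_of_nonneg (indicator_nonneg (fun x _ => hp0 x) x)]
  have huS : AEMeasurable u (volume.restrict S) :=
    (hum.mono_measure (Measure.restrict_mono hSU le_rfl)).aemeasurable
  have hpA : ∀ x, A (p x) ≤ 2 ^ m * (A (‖g x‖ / R) + A (‖u x‖ / R)) := fun x => by
    simp only [hp, add_div]
    exact hA.add_le hl (by positivity) (by positivity)
  have hfint : ∫⁻ x, ENNReal.ofReal (A (f x)) ≤ ENNReal.ofReal (2 ^ m * (1 + Λ)) := by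
    have hAg : AEMeasurable (fun x => ENNReal.ofReal (A (‖g x‖ / R))) (volume.restrict U) := by
      have := hA.continuous_comp_abs.measurable.comp_aemeasurable
        (hgm.norm.aemeasurable.div_const R)
      refine AEMeasurable.ennreal_ofReal (this.congr (ae_of_all _ fun x => ?_))
      simp only [Function.comp_apply]
      rw [abs_of_nonneg (by positivity)]
    calc ∫⁻ x, ENNReal.ofReal (A (f x))
        = ∫⁻ x in U, ENNReal.ofReal (A (p x)) := by
          rw [← lintegral_indicator hU]
          refine lintegral_congr_ae ?_
          filter_upwards [hfe] with x hx
          rw [← hx]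
          by_cases hxU : x ∈ U <;> simp [hxU, hA.zero]
      _ ≤ ∫⁻ x in U, ENNReal.ofReal (2 ^ m) *
            (ENNReal.ofReal (A (‖g x‖ / R)) + ENNReal.ofReal (A (‖u x‖ / R))) := by
          refine lintegral_mono fun x => ?_
          dsimp only
          rw [← ENNReal.ofReal_add (hA.nonneg (by positivity)) (hA.nonneg (by positivity)),
            ← ENNReal.ofReal_mul (by positivity)]
          exact ENNReal.ofReal_le_ofReal (hpA x)
      _ ≤ ENNReal.ofReal (2 ^ m) * (1 + ENNReal.ofReal Λ) := by
          rw [lintegral_const_mul' _ _ ENNReal.ofReal_ne_top, lintegral_add_left' hAg]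
          gcongr
      _ = _ := by
          rw [ENNReal.ofReal_mul (by positivity), ENNReal.ofReal_add zero_le_one hΛ.le,
            ENNReal.ofReal_one]
  have hmk := (ae_restrict_iff' hS).1 huS.ae_eq_mk
  have havg : ∀ (q : EuclideanSpace ℝ (Fin N) → ℝ≥0∞),
      (∀ x, q x ≤ ENNReal.ofReal R * ENNReal.ofReal (p x)) → ∀ k x,
      ballAvg h (U.indicator q) k x ≤
        ENNReal.ofReal R * ballAvg h (fun y => ENNReal.ofReal (f y)) k x := by
    intro q hq k x
    have hae : (fun y => ENNReal.ofReal R * ENNReal.ofReal (f y)) =ᵐ[volume]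
        fun y => ENNReal.ofReal R * ENNReal.ofReal (U.indicator p y) := by
      filter_upwards [hfe] with y hy
      rw [hy]
    rw [← ballAvg_const_mul hfm.ennreal_ofReal, ballAvg_congr h hae]
    refine ballAvg_mono h (fun y => ?_) k x
    by_cases hy : y ∈ U
    · simpa [hy] using hq y
    · simp [hy]
  have hup : ∀ x, ‖u x‖ₑ ≤ ENNReal.ofReal R * ENNReal.ofReal (p x) := fun x => by
    rw [← ENNReal.ofReal_mul hR.le, ← ofReal_norm, hp, mul_div_cancel₀ _ hR.ne']
    exact ENNReal.ofReal_le_ofReal (le_add_of_nonneg_left (norm_nonneg _))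
  have hgp : ∀ x, ‖g x‖ₑ ≤ ENNReal.ofReal R * ENNReal.ofReal (p x) := fun x => by
    rw [← ENNReal.ofReal_mul hR.le, ← ofReal_norm, hp, mul_div_cancel₀ _ hR.ne']
    exact ENNReal.ofReal_le_ofReal (le_add_of_nonneg_right (norm_nonneg _))
  refine ⟨huS.mk u, f, huS.ae_eq_mk, hS, huS.measurable_mk, hfm, fun x => abs_nonneg _, hfint,
    ?_, ?_⟩
  · filter_upwards [hmk, hfe] with x hx1 hx2 hxS
    rw [← hx1 hxS, ← hx2, indicator_of_mem (hSU hxS), hp, mul_div_cancel₀ _ hR.ne',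
      Real.norm_eq_abs (u x)]
    exact le_add_of_nonneg_left (norm_nonneg _)
  · filter_upwards [hmk, hpot U hU u g hug hloc] with x hx1 hx2 hxS j
    rw [← hx1 hxS]
    refine (hx2 (hSU hxS) (hcone x hxS) j).trans ?_
    rw [ENNReal.ofReal_mul hC.le, mul_assoc, mul_add (ENNReal.ofReal R), ← ENNReal.tsum_mul_left]
    refine mul_le_mul_right (add_le_add (havg _ hup j x) (ENNReal.tsum_le_tsum fun k => ?_)) _
    rw [mul_left_comm]
    exact mul_le_mul_right (havg _ hgp (j + k) x) _

end OrliczSobolev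

lemma isWeakGradient_weakGradient {N : ℕ} {U : Set (EuclideanSpace ℝ (Fin N))}
    {u : EuclideanSpace ℝ (Fin N) → ℝ} (h : ∃ g, IsWeakGradient U u g) :
    IsWeakGradient U u (weakGradient U u) := by
  rw [weakGradient, dif_pos h]
  exact h.choose_spec

theorem proposition5p3 (N : ℕ) (hN : 2 ≤ N)
    (φ : ℝ → ℝ) (hφ_smooth : ContDiffOn ℝ 1 φ (Ioi 0))
    (hφ1 : ∀ t : ℝ, 0 < t → 0 < φ t ∧ 0 < deriv (fun s => φ s * s) t)
    (l m : ℝ) (hl : 1 < l) (hlm : l ≤ m) (hmN : m < N) (hml : m < N * l / (N - l))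
    (hφ2 : ∀ t : ℝ, 0 < t →
      l ≤ φ t * t ^ 2 / primitivePhi φ t ∧ φ t * t ^ 2 / primitivePhi φ t ≤ m)
    (V : EuclideanSpace ℝ (Fin N) → ℝ) (hV : Continuous V)
    (V₀ : ℝ) (hV₀ : 0 < V₀) (hVV₀ : ∀ z, V₀ ≤ V z)
    (Ω : Set (EuclideanSpace ℝ (Fin N))) (hΩ : IsOpen Ω) (hΩb : Bornology.IsBounded Ω)
    (Ωt : ℝ → Set (EuclideanSpace ℝ (Fin N)))
    (hΩt : ∀ ε : ℝ, 0 < ε → IsOpen (Ωt ε))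
    (hΩΩt : ∀ ε : ℝ, 0 < ε → closure (dilate Ω ε) ⊆ Ωt ε)
    (hcone : UniformConeIn Ω Ωt)
    (ρ : ℝ) (hρ : 0 < ρ)
    (ε : ℕ → ℝ) (hε : ∀ n, 0 < ε n) (hε0 : Tendsto ε atTop (𝓝 0))
    (v : ℕ → EuclideanSpace ℝ (Fin N) → ℝ)
    (hv : ∀ n, MemOrliczSobolev (primitivePhi φ) (Ωt (ε n)) (v n))
    (C₀ : ℝ) (hC₀ : 0 < C₀)
    (hbdd : ∀ n, normX (primitivePhi φ) V (ε n) (Ωt (ε n)) (v n) ≤ ENNReal.ofReal C₀)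
    (hvanish : Tendsto
      (fun n => ⨆ y : EuclideanSpace ℝ (Fin N),
        ∫⁻ x in Metric.ball y ρ ∩ dilate Ω (ε n), ENNReal.ofReal (primitivePhi φ |v n x|))
      atTop (𝓝 0)) :
    ∀ B : ℝ → ℝ, IsNFunction B → SatisfiesDelta2 B →
      Tendsto (fun t => B t / primitivePhi φ t) (𝓝[≠] 0) (𝓝 0) →
      Tendsto (fun t => B t / sobolevConj N (primitivePhi φ) t)
        (Bornology.cobounded ℝ) (𝓝 0) →
      Tendsto (fun n => ∫⁻ x in dilate Ω (ε n), ENNReal.ofReal (B |v n x|)) atTop (𝓝 0) := by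
  intro B hB hBΔ hB0 hBinf
  set A := primitivePhi φ
  have hA : HasGrowthBetween A l m := hasGrowthBetween_primitivePhi hφ_smooth hφ1 hφ2
  have hm : 0 < m := by linarith
  obtain ⟨h, c, ε₀, hh, hc0, hc1, hε₀, hcones⟩ := hcone
  have hR : C₀ < 2 * C₀ := by linarith
  have hR0 : 0 < 2 * C₀ := by linarith
  obtain ⟨C, hC, hbound⟩ := hA.exists_hasPotentialBound (N := N) hl.le hh hc0 hc1 hR0
    (inv_pos.2 hV₀)
  have hS : ∀ n, MeasurableSet (dilate Ω (ε n)) := fun n =>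
    (hΩ.preimage (continuous_const_smul (ε n))).measurableSet
  have hex : ∀ n, ∃ u' : EuclideanSpace ℝ (Fin N) → ℝ,
      v n =ᵐ[volume.restrict (dilate Ω (ε n))] u' ∧ (ε n < ε₀ →
        ∃ f, HasPotentialBound A h C (2 * C₀) (2 ^ m * (1 + V₀⁻¹)) (dilate Ω (ε n)) u' f) := by
    intro n
    by_cases hn : ε n < ε₀
    swap
    · exact ⟨v n, EventuallyEq.rfl, fun h => absurd h hn⟩
    obtain ⟨g, hg, -⟩ := (hv n).2
    have hgrad := isWeakGradient_weakGradient ⟨g, hg⟩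
    have hgint := hA.lintegral_le_one_of_luxemburgNorm_le hl.le (fun _ => zero_le_one) hR hR0
      (le_self_add.trans (hbdd n))
    have hvint := hA.lintegral_le_one_of_luxemburgNorm_le hl.le
      (fun x => hV₀.le.trans (hVV₀ (ε n • x))) hR hR0 (le_add_self.trans (hbdd n))
    simp only [one_mul] at hgint
    have hvint' : ∫⁻ x in Ωt (ε n), ENNReal.ofReal (A (‖v n x‖ / (2 * C₀))) ≤
        ENNReal.ofReal V₀⁻¹ := by
      rw [ENNReal.ofReal_inv_of_pos hV₀, ← one_div, ENNReal.le_div_iff_mul_le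
        (Or.inl (by simpa using hV₀)) (Or.inl ENNReal.ofReal_ne_top), mul_comm,
        ← lintegral_const_mul' _ _ ENNReal.ofReal_ne_top]
      refine (lintegral_mono fun x => ?_).trans hvint
      rw [← ENNReal.ofReal_mul hV₀.le]
      exact ENNReal.ofReal_le_ofReal
        (mul_le_mul_of_nonneg_right (hVV₀ _) (hA.nonneg (by positivity)))
    obtain ⟨u', f, hu', hf⟩ := hbound (Ωt (ε n)) (dilate Ω (ε n))
      (hΩt _ (hε n)).measurableSet (hS n) (subset_closure.trans (hΩΩt _ (hε n)))
      (hcones _ (hε n) hn) (v n) _ hgrad hgint hvint'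
    exact ⟨u', hu', fun _ => ⟨f, hf⟩⟩
  choose u' hu' hf using hex
  have hvanish' : Tendsto (fun n => ⨆ y : EuclideanSpace ℝ (Fin N),
      ∫⁻ x in Metric.ball y ρ ∩ dilate Ω (ε n), ENNReal.ofReal (A |u' n x|)) atTop (𝓝 0) := by
    refine hvanish.congr fun n => iSup_congr fun y => lintegral_congr_ae ?_
    filter_upwards [ae_restrict_of_ae_restrict_of_subset inter_subset_right (hu' n)] with x hx
    rw [hx]
  refine (hA.tendsto_lintegral_zero hl hm (by omega) hmN hh hC
    (by have := inv_pos.2 hV₀; positivity) hρ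
    ((hε0.eventually_lt_const hε₀).mono hf) hvanish' hB hBΔ hB0 hBinf).congr fun n => ?_
  refine lintegral_congr_ae ?_
  filter_upwards [hu' n] with x hx
  rw [hx]
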